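/- Logarithms are to base $2$. Let $K\ge 1$. The $K$-user integer-interference channel with direct gains $h=(h_{11},\dots,h_{KK})\in\mathbb R^K$ and integer cross gains $a_{jk}$ $(j\ne k)$ is $$Y_j=h_{jj}X_j+\sum_{k\ne j}a_{jk}X_k+Z_j,\qquad j=1,\dots,K,$$ with independent noises $Z_j\sim N(0,1/\mathrm{SNR})$, i.i.d. in time, and power constraint $\frac1n\mathbb E\|\mathbf x_k\|^2\le 1$ for every user. For a prime $p$ and $\gamma\in\mathbb R$ let $\delta(p,\gamma)=\min_{1\le l\le p-1} l\,\bigl|\gamma-\tfrac{\lfloor l\gamma\rceil}{l}\bigr|$, where $\lfloor\cdot\rceil$ is rounding to the nearest integer, let $\gamma_{\bmod[-1/4,1/4)}\in[-\frac14,\frac14)$ be $\gamma$ reduced modulo $\frac12$, and let $$\mathcal P'(\gamma)=\Bigl\{p\text{ prime}: e^{-\frac{3\,\mathrm{SNR}}{2p^2}\left(\gamma_{\bmod[-1/4,1/4)}\right)^2}<1-2p\,e^{-3\,\mathrm{SNR}/8}\Bigr\}.$$ Let $R_{\mathrm{sym}}(p,\mathrm{SNR})$ be the minimum over $j=1,\dots,K$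 of the two numbers $$-\tfrac12\log\Bigl(\tfrac1{p^2}+\sqrt{\tfrac{2\pi/3}{\mathrm{SNR}}}+\tfrac1p e^{-\frac{3\,\mathrm{SNR}}{2p^2}\delta^2(p,h_{jj})}+2e^{-\frac{3\,\mathrm{SNR}}8}\Bigr),\qquad -\log\Bigl(\tfrac1p+\sqrt{\tfrac{2\pi/3}{\delta^2(p,h_{jj})\,\mathrm{SNR}}}+2e^{-\frac{3\,\mathrm{SNR}}8}\Bigr)$$ (equal to $-\infty$ if some $\delta(p,h_{jj})=0$), and let $R_{\mathrm{sym}}(\mathrm{SNR})=\max_{p\in\bigcap_j\mathcal P'(h_{jj})}R_{\mathrm{sym}}(p,\mathrm{SNR})$. A lattice-alignment code over $\mathbb Z_p$ of block length $n$ and rate $R$ is one in which all users use the same linear codebook: for one matrix $G\in\mathbb Z_p^{d\times n}$ with $d=\lfloor nR/\log p\rfloor$, user $k$ sends $\mathbf x_k=\bigl[\tfrac{L}{p}\mathbf w_k^TG\bigr]^*$ for its message $\mathbf w_k\in\mathbb Z_p^d$, where $L=\sqrt{12}$ and $[\cdot]^*$ is componentwise reduction modulo $[-L/2,L/2)$;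 every receiver first applies $[\cdot]^*$ to its observation. For a sequence of codes (one for each $n$), a rate tuple $(R_1,\dots,R_K)$ of nonnegative numbers is achievable if the probability that some receiver errs, for uniform independent messages, tends to $0$ as $n\to\infty$, and for every $\eta>0$ user $k$ has at least $2^{n(R_k-\eta)}$ messages for all large $n$. A coding scheme (such a sequence of codes for every SNR) achieves $d$ degrees of freedom if $$\limsup_{\mathrm{SNR}\to\infty}\ \max_{(R_1,\dots,R_K)\text{ achievable}}\ \frac{\sum_k R_k}{\frac12\log\mathrm{SNR}}=d .$$ Then the following hold for all integers $a_{jk}$. 1. For almost every $\gamma\in\mathbb R$ and every $\varepsilon>0$, $\delta(p,\gamma)\ge p^{-1-\varepsilon}$ for all sufficiently large $p$. 2. For almost every $h\in\mathbb R^K$: (a) For every $\varepsilon\in(0,\frac14)$ and all primes $p=p(\mathrm{SNR})=\mathrm{SNR}^{1/4-\varepsilon(\mathrm{SNR})}$ with $\varepsilon(\mathrm{SNR})\to\varepsilon$ as $\mathrm{SNR}\to\infty$, one has $p\in\bigcap_j\mathcal P'(h_{jj})$ for all large SNR, and $R_{\mathrm{sym}}(p,\mathrm{SNR})/(\frac14\log\mathrm{SNR})\to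 1-4\varepsilon$. (b) For all large SNR the maximum $R_{\mathrm{sym}}(\mathrm{SNR})$ is attained, and $R_{\mathrm{sym}}(\mathrm{SNR})/(\frac14\log\mathrm{SNR})\to 1$ as $\mathrm{SNR}\to\infty$. (c) There are primes $p=p(\mathrm{SNR})=\mathrm{SNR}^{1/4-\varepsilon(\mathrm{SNR})}$ (for all large SNR) with $\varepsilon(\mathrm{SNR})>0$, $\varepsilon(\mathrm{SNR})\to0$, such that $p\in\bigcap_j\mathcal P'(h_{jj})$ for all large SNR and $R_{\mathrm{sym}}(p,\mathrm{SNR})/(\frac14\log\mathrm{SNR})\to1$; and there is a coding scheme of lattice-alignment codes over $\mathbb Z_{p(\mathrm{SNR})}$, of rate $R(\mathrm{SNR})$ with $0<R(\mathrm{SNR})<R_{\mathrm{sym}}(p,\mathrm{SNR})$ for all large SNR, for which the symmetric rate $R(\mathrm{SNR})$ is achievable for all large SNR and which achieves $K/2$ degrees of freedom. -/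

import Mathlib

open Filter Topology MeasureTheory ProbabilityTheory

/-! ### Modular reductions and the Diophantine quantity -/

/-- The length `L = √12` of the basic interval `[-L/2, L/2)`. -/
noncomputable def latL : ℝ := Real.sqrt 12

theorem latL_pos : 0 < latL := Real.sqrt_pos.mpr (by norm_num)

/-- `x^*`: the reduction of `x` modulo the basic interval `[-L/2, L/2)`. -/
noncomputable def modBasic (x : ℝ) : ℝ := toIcoMod latL_pos (-(latL / 2)) x

theorem half_pos_real : (0 : ℝ) < 1 / 2 := by norm_num

/-- The reduction of `x` modulo the interval `[-1/4, 1/4)`. -/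
noncomputable def modQuarter (x : ℝ) : ℝ := toIcoMod half_pos_real (-(1 / 4)) x

/-- `δ(p, γ) = min_{1 ≤ l ≤ p - 1} l * |γ - ⌊lγ⌉ / l|` (for `p ≥ 2` the infimum is over a finite
nonempty set, so it is a minimum). -/
noncomputable def dioDelta (p : ℕ) (γ : ℝ) : ℝ :=
  sInf ((fun l : ℕ => (l : ℝ) * |γ - (round ((l : ℝ) * γ) : ℝ) / (l : ℝ)|) '' Set.Ico 1 p)

/-! ### The explicit symmetric rate (logarithms to base two) -/

/-- The set `𝒫'(γ)` of admissible primes at signal-to-noise ratio `S`. -/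
def admissiblePrimes (S γ : ℝ) : Set ℕ :=
  {p | p.Prime ∧
    Real.exp (-(3 * S / (2 * (p : ℝ) ^ 2)) * modQuarter γ ^ 2)
      < 1 - 2 * (p : ℝ) * Real.exp (-(3 * S / 8))}

/-- The argument of the logarithm in the first rate bound. -/
noncomputable def firstArg (p : ℕ) (S γ : ℝ) : ℝ :=
  1 / (p : ℝ) ^ 2 + Real.sqrt ((2 * Real.pi / 3) / S)
    + 1 / (p : ℝ) * Real.exp (-(3 * S / (2 * (p : ℝ) ^ 2)) * dioDelta p γ ^ 2)
    + 2 * Real.exp (-(3 * S / 8))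

/-- The argument of the logarithm in the second rate bound (meaningful for `δ(p, γ) > 0`; as
`δ(p, γ)` tends to `0` it tends to `∞`). -/
noncomputable def secondArg (p : ℕ) (S γ : ℝ) : ℝ :=
  1 / (p : ℝ) + Real.sqrt ((2 * Real.pi / 3) / (dioDelta p γ ^ 2 * S))
    + 2 * Real.exp (-(3 * S / 8))

/-- The symmetric rate for direct gains `h` and a given prime `p`: the minimum over all receivers
of the two rate bounds. -/
noncomputable def symRateAt {K : ℕ} (h : Fin K → ℝ) (p : ℕ) (S : ℝ) : ℝ :=
  ⨅ j : Fin K, min (-(1 / 2) * Real.logb 2 (firstArg p S (h j)))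
    (-Real.logb 2 (secondArg p S (h j)))

/-- The rates over which the symmetric rate is maximized: `p` ranges over `⋂ j, 𝒫'(h j)`.
A prime with `δ(p, h j) = 0` for some `j` has rate `-∞` and does not contribute. -/
def symRateValues {K : ℕ} (h : Fin K → ℝ) (S : ℝ) : Set ℝ :=
  {r | ∃ p : ℕ, (∀ j, p ∈ admissiblePrimes S (h j)) ∧ (∀ j, 0 < dioDelta p (h j)) ∧
    r = symRateAt h p S}

/-- The symmetric rate: the maximum over the admissible primes. -/
noncomputable def symRate {K : ℕ} (h : Fin K → ℝ) (S : ℝ) : ℝ := sSup (symRateValues h S)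

/-! ### The Gaussian interference channel, its codes and degrees of freedom -/

/-- Gain matrix of an integer-interference channel: direct gains `h j`, cross gains `a j k`
for `k ≠ j` (the diagonal of `a` is not used). -/
def integerGains {K : ℕ} (h : Fin K → ℝ) (a : Fin K → Fin K → ℤ) : Fin K → Fin K → ℝ :=
  fun j k => if j = k then h j else (a j k : ℝ)

/-- A code of block length `n` for the `K`-user interference channel: user `k` has `M k` messages,
an encoder that satisfies the power constraint `(1/n) E‖x_k‖² ≤ 1` (expectation over a uniform
message), and receiver `k` has a decoder. -/
structure ICCode (K n : ℕ) where
  M : Fin K → ℕ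
  enc : (k : Fin K) → Fin (M k) → (Fin n → ℝ)
  dec : (k : Fin K) → (Fin n → ℝ) → Fin (M k)
  measurable_dec : ∀ k, Measurable (dec k)
  power : ∀ k, ∑ w, ∑ t, enc k w t ^ 2 ≤ (M k : ℝ) * (n : ℝ)

/-- The law of the noise: all components are independent, centred Gaussian of variance `1/S`. -/
noncomputable def noiseLaw (K n : ℕ) (S : ℝ) : Measure (Fin K → Fin n → ℝ) :=
  Measure.pi fun _ => Measure.pi fun _ => gaussianReal 0 (Real.toNNReal (1 / S))

/-- The signal `y_j = ∑ k, H j k * x_k + z_j` at receiver `j` when the messages are `w`. -/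
def ICCode.received {K n : ℕ} (c : ICCode K n) (H : Fin K → Fin K → ℝ)
    (w : (k : Fin K) → Fin (c.M k)) (z : Fin K → Fin n → ℝ) (j : Fin K) : Fin n → ℝ :=
  fun t => ∑ k, H j k * c.enc k (w k) t + z j t

/-- The probability, over uniform messages and the noise, that some receiver errs. -/
noncomputable def ICCode.errorProb {K n : ℕ} (c : ICCode K n) (H : Fin K → Fin K → ℝ)
    (S : ℝ) : ℝ :=
  (∑ w : (k : Fin K) → Fin (c.M k),
      (noiseLaw K n S).real {z | ∃ j, c.dec j (c.received H w z j) ≠ w j})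
    / ∏ k, (c.M k : ℝ)

/-- The rate tuples achievable with a given sequence of codes (one for each block length `n`): the
error probability vanishes, and the number of messages of user `k` is asymptotically at least
`2^{n R_k}` to first order in the exponent. -/
def achievableRates {K : ℕ} (H : Fin K → Fin K → ℝ) (S : ℝ) (c : (n : ℕ) → ICCode K n) :
    Set (Fin K → ℝ) :=
  {R | (∀ k, 0 ≤ R k) ∧
    (∀ k, ∀ η : ℝ, 0 < η → ∀ᶠ n : ℕ in atTop,
      (2 : ℝ) ^ ((n : ℝ) * (R k - η)) ≤ ((c n).M k : ℝ)) ∧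
    Tendsto (fun n => (c n).errorProb H S) atTop (𝓝 0)}

/-- A coding scheme (a sequence of codes for every `S`) achieves `d` degrees of freedom if
`limsup_{S → ∞} max_R (∑ k, R k) / (½ log S) = d`, where `R` ranges over the rate tuples achievable
with the codes for `S`. Values are in `EReal`, so that an empty maximum is `-∞`. -/
def AchievesDoF {K : ℕ} (H : Fin K → Fin K → ℝ) (C : ℝ → (n : ℕ) → ICCode K n) (d : ℝ) : Prop :=
  limsup (fun S : ℝ => ⨆ R ∈ achievableRates H S (C S),
    (((∑ k, R k) / (1 / 2 * Real.logb 2 S) : ℝ) : EReal)) atTop = (d : EReal)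

/-! ### The lattice-alignment scheme -/

/-- The codeword `[(L/p) wᵀ G]^*` of the message vector `w` for the generating matrix `G` over
`ℤ_p` (representatives `0, …, p - 1`). -/
noncomputable def linearCodeword {p d n : ℕ} (G : Matrix (Fin d) (Fin n) (ZMod p))
    (w : Fin d → ZMod p) : Fin n → ℝ :=
  fun t => modBasic (latL / (p : ℝ) * ((Matrix.vecMul w G t).val : ℝ))

/-- The code is a lattice-alignment code over `ℤ_p` with message vectors of length `d`: all users
encode with the same linear codebook, generated by one matrix `G`, and every receiver first reduces
its observation modulo the basic interval. -/
def ICCode.IsLatticeAlignment {K n : ℕ} (c : ICCode K n) (p d : ℕ) : Prop :=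
  (∃ (G : Matrix (Fin d) (Fin n) (ZMod p)) (e : (k : Fin K) → Fin (c.M k) ≃ (Fin d → ZMod p)),
      ∀ k w, c.enc k w = linearCodeword G (e k w)) ∧
    ∀ j y, c.dec j y = c.dec j (fun t => modBasic (y t))

/-! ### Diophantine approximation -/

/-! Almost every gain is irrational and not Liouville of any exponent above 2, which gives `δ(p, γ)
≥ p^(-1-ε)` (`ae_diophantineGain`). For `p` a small power of `S` below `S^(1/4)` this yields `δ² S /
p² ≥ S^ε`. Every term in the two logarithms is then `O(p⁻²)`, respectively `O(p⁻¹)`, so the rate is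
`log p - O(1)`. It never exceeds `log p`, nor `¼ log S` for any `p`; this settles the asymptotics,
with primes supplied by Bertrand's postulate.

For the codes, degrees of freedom tolerate any loss that is `o(log S)`, so cruder coding than random
coding with joint decoding suffices. All codewords have letters in `(L/p)ℤ`, hence integer
interference and reduction modulo `L` only shift the desired letter `(L/p) γ s` by an element of
`(L/p)ℤ`. Distinct `s` stay `(L/p) δ` apart (`decisionRegion_unique`), so each symbol can be decided
separately, with error probability of order `S^(-ε)` by Chebyshev. A Gilbert–Varshamov linear code
of relative distance about `1/N` corrects the remaining errors, at a cost of one bit plus `(log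
p)/N` per symbol (`exists_latticeAlignment_errorProb_le`). Letting `N → ∞` slowly with `S` gives
rate `~ ¼ log S` per user. The number of messages caps every achievable rate of this scheme, so the
limsup is exactly `K/2`. -/

theorem natCast_mul_abs_sub_div {l : ℕ} (hl : 1 ≤ l) (γ x : ℝ) :
    (l : ℝ) * |γ - x / l| = |(l : ℝ) * γ - x| := by
  have hl0 : (0 : ℝ) < l := by exact_mod_cast hl
  nth_rewrite 1 [← abs_of_pos hl0]
  rw [← abs_mul]
  congr 1
  field_simp

theorem dioDelta_le {p l : ℕ} (hl : 1 ≤ l) (hlp : l < p) (γ : ℝ) (m : ℤ) :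
    dioDelta p γ ≤ |(l : ℝ) * γ - m| := by
  have hbdd : BddBelow ((fun l : ℕ => (l : ℝ) * |γ - (round ((l : ℝ) * γ) : ℝ) / (l : ℝ)|) ''
      Set.Ico 1 p) := ⟨0, by rintro _ ⟨k, -, rfl⟩; positivity⟩
  refine (csInf_le hbdd ⟨l, ⟨hl, hlp⟩, rfl⟩).trans ?_
  exact (natCast_mul_abs_sub_div hl γ _).le.trans (round_le _ m)

theorem le_dioDelta {p : ℕ} (hp : 2 ≤ p) {γ c : ℝ}
    (h : ∀ l : ℕ, 1 ≤ l → l < p → ∀ m : ℤ, c ≤ |(l : ℝ) * γ - m|) : c ≤ dioDelta p γ := by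
  refine le_csInf ⟨_, 1, ⟨le_rfl, hp⟩, rfl⟩ ?_
  rintro _ ⟨l, ⟨hl, hlp⟩, rfl⟩
  exact (h l hl hlp (round ((l : ℝ) * γ))).trans (natCast_mul_abs_sub_div hl γ _).ge

theorem dioDelta_le_int {p : ℕ} {l : ℤ} (hl : l ≠ 0) (hlp : |l| < p) (γ : ℝ) (m : ℤ) :
    dioDelta p γ ≤ |(l : ℝ) * γ + m| := by
  obtain ⟨k, rfl | rfl⟩ := l.eq_nat_or_neg
  · have := dioDelta_le (p := p) (l := k) (by omega) (by simpa using hlp) γ (-m)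
    simpa using this
  · have := dioDelta_le (p := p) (l := k) (by omega) (by simpa using hlp) γ m
    rw [← abs_neg]
    refine this.trans (le_of_eq ?_)
    congr 1
    push_cast
    ring

theorem Irrational.dioDelta_pos {γ : ℝ} (hγ : Irrational γ) {p : ℕ} (hp : 2 ≤ p) :
    0 < dioDelta p γ := by
  have hmem : dioDelta p γ ∈ ((fun l : ℕ => (l : ℝ) * |γ - (round ((l : ℝ) * γ) : ℝ) / (l : ℝ)|) ''
      Set.Ico 1 p) :=
    Set.Nonempty.csInf_mem ⟨_, 1, ⟨le_rfl, hp⟩, rfl⟩ ((Set.finite_Ico 1 p).image _)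
  obtain ⟨l, ⟨hl, -⟩, h⟩ := hmem
  rw [← h]
  have hl0 : (0 : ℝ) < l := by exact_mod_cast hl
  refine mul_pos hl0 (abs_pos.mpr (sub_ne_zero.mpr fun h => ?_))
  exact hγ ⟨(round ((l : ℝ) * γ) : ℚ) / l, by push_cast; exact h.symm⟩

/-- Gains that are irrational and not approximable to any exponent larger than two. -/
def DiophantineGain (γ : ℝ) : Prop :=
  Irrational γ ∧ ∀ ε : ℝ, 0 < ε → ∀ᶠ p : ℕ in atTop, (p : ℝ) ^ (-1 - ε) ≤ dioDelta p γ

/-- The non-Liouville bound holds only for large denominators `l`. The finitely many small `l`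
contribute a positive constant, by irrationality, and `p^(-1-ε)` eventually drops below it. -/
theorem ae_diophantineGain : ∀ᵐ γ : ℝ, DiophantineGain γ := by
  have hirr : ∀ᵐ γ : ℝ, Irrational γ := (Set.countable_range ((↑) : ℚ → ℝ)).ae_notMem _
  filter_upwards [hirr, ae_not_liouvilleWith] with γ hγ hL
  refine ⟨hγ, fun ε hε => ?_⟩
  have h1 : ¬ ∃ᶠ n : ℕ in atTop, ∃ m : ℤ, γ ≠ m / n ∧ |γ - m / n| < 1 / (n : ℝ) ^ (2 + ε) :=
    fun h => hL (2 + ε) (by linarith) ⟨1, h⟩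
  rw [not_frequently] at h1
  obtain ⟨N, hN⟩ := eventually_atTop.mp h1
  have hc := hγ.dioDelta_pos (p := N + 2) (by omega)
  have hlim : Tendsto (fun p : ℕ => (p : ℝ) ^ (-(1 + ε))) atTop (𝓝 0) :=
    (tendsto_rpow_neg_atTop (by linarith)).comp tendsto_natCast_atTop_atTop
  filter_upwards [hlim.eventually_le_const hc, eventually_ge_atTop 2] with p hp hp2
  rw [show -1 - ε = -(1 + ε) by ring]
  refine le_dioDelta hp2 fun l hl hlp m => ?_
  rcases lt_or_ge l N with hlN | hlN
  · exact hp.trans (dioDelta_le hl (by omega) γ m)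
  · have hl0 : (0 : ℝ) < l := by exact_mod_cast hl
    have h2 := hN l hlN
    push Not at h2
    have h3 := h2 m fun h => hγ ⟨(m : ℚ) / l, by rw [h]; push_cast; rfl⟩
    have h4 : (p : ℝ) ^ (-(1 + ε)) ≤ (l : ℝ) ^ (-(1 + ε)) :=
      Real.rpow_le_rpow_of_nonpos hl0 (by exact_mod_cast hlp.le) (by linarith)
    refine h4.trans ?_
    have h5 : (l : ℝ) ^ (-(1 + ε)) = l * (1 / (l : ℝ) ^ (2 + ε)) := by
      rw [Real.rpow_neg hl0.le, show 2 + ε = (1 + ε) + 1 by ring, Real.rpow_add_one hl0.ne']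
      field_simp
    rw [h5]
    exact (mul_le_mul_of_nonneg_left h3 hl0.le).trans (natCast_mul_abs_sub_div hl γ m).le

theorem ae_forall_diophantineGain (K : ℕ) :
    ∀ᵐ h : Fin K → ℝ, ∀ j, DiophantineGain (h j) := by
  rw [ae_all_iff]
  intro j
  exact (Measure.tendsto_eval_ae_ae (μ := fun _ : Fin K => (volume : Measure ℝ)) (i := j)).eventually
    ae_diophantineGain

/-- Keeps the exponent in the admissibility condition strictly negative. -/
theorem Irrational.modQuarter_ne_zero {γ : ℝ} (hγ : Irrational γ) : modQuarter γ ≠ 0 := by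
  intro h
  have h1 := self_sub_toIcoDiv_zsmul half_pos_real (-(1 / 4)) γ
  rw [show toIcoMod half_pos_real (-(1 / 4)) γ = 0 from h] at h1
  refine hγ ⟨(toIcoDiv half_pos_real (-(1 / 4)) γ : ℚ) * (1 / 2), ?_⟩
  push_cast
  rw [zsmul_eq_mul] at h1
  linarith

/-! ### Bounds for the rate at a fixed signal-to-noise ratio -/

theorem firstArg_pos {p : ℕ} {S : ℝ} (γ : ℝ) : 0 < firstArg p S γ := by
  unfold firstArg
  positivity

theorem secondArg_pos {p : ℕ} {S : ℝ} (γ : ℝ) : 0 < secondArg p S γ := by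
  unfold secondArg
  positivity

theorem sqrt_le_firstArg (p : ℕ) (S γ : ℝ) :
    Real.sqrt ((2 * Real.pi / 3) / S) ≤ firstArg p S γ := by
  have h1 : (0 : ℝ) ≤ 1 / (p : ℝ) ^ 2 := by positivity
  have h2 : (0 : ℝ) ≤ 1 / (p : ℝ) * Real.exp (-(3 * S / (2 * (p : ℝ) ^ 2)) * dioDelta p γ ^ 2) := by
    positivity
  have h3 := Real.exp_pos (-(3 * S / 8))
  unfold firstArg
  linarith

theorem inv_le_secondArg (p : ℕ) (S γ : ℝ) : 1 / (p : ℝ) ≤ secondArg p S γ := by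
  have h1 := Real.sqrt_nonneg ((2 * Real.pi / 3) / (dioDelta p γ ^ 2 * S))
  have h3 := Real.exp_pos (-(3 * S / 8))
  unfold secondArg
  linarith

theorem sqrt_div_sq_le {x : ℝ} (hx : 0 < x) {y : ℝ} (hy : x ^ 2 ≤ y) :
    Real.sqrt ((2 * Real.pi / 3) / y) ≤ 2 / x := by
  rw [Real.sqrt_le_left (by positivity)]
  have hpi := Real.pi_lt_four
  have hx2 : 0 < x ^ 2 := by positivity
  calc (2 * Real.pi / 3) / y ≤ (2 * Real.pi / 3) / x ^ 2 := by gcongr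
    _ ≤ 4 / x ^ 2 := by gcongr; linarith
    _ = (2 / x) ^ 2 := by ring

/-- The parameter `u` is a lower bound for `δ² S / p²`, later taken to be `S^ε`. In units of `p⁻²`
the four terms are at most 1, 2, 1 and 2. -/
theorem firstArg_le {p : ℕ} {S γ u : ℝ} (hp : 1 ≤ p) (hS : (p : ℝ) ^ 4 ≤ S)
    (hδ : u * (p : ℝ) ^ 2 ≤ dioDelta p γ ^ 2 * S) (h1 : (p : ℝ) * Real.exp (-u) ≤ 1)
    (hu : 0 ≤ u) (h2 : (p : ℝ) ^ 2 * Real.exp (-(3 * S / 8)) ≤ 1) :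
    firstArg p S γ ≤ 6 / (p : ℝ) ^ 2 := by
  have hp0 : (0 : ℝ) < p := by exact_mod_cast hp
  have e1 : Real.sqrt ((2 * Real.pi / 3) / S) ≤ 2 / (p : ℝ) ^ 2 :=
    sqrt_div_sq_le (by positivity) (by rw [← pow_mul]; exact hS)
  have e2 : Real.exp (-(3 * S / (2 * (p : ℝ) ^ 2)) * dioDelta p γ ^ 2) ≤ 1 / p := by
    rw [le_div_iff₀ hp0, mul_comm]
    refine le_trans (mul_le_mul_of_nonneg_left (Real.exp_le_exp.mpr ?_) hp0.le) h1
    have : u ≤ dioDelta p γ ^ 2 * S / (p : ℝ) ^ 2 := by rwa [le_div_iff₀ (by positivity)]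
    have e : -(3 * S / (2 * (p : ℝ) ^ 2)) * dioDelta p γ ^ 2
        = -(3 / 2) * (dioDelta p γ ^ 2 * S / (p : ℝ) ^ 2) := by
      field_simp
    rw [e]
    linarith
  have e3 : Real.exp (-(3 * S / 8)) ≤ 1 / (p : ℝ) ^ 2 := by
    rw [le_div_iff₀ (by positivity), mul_comm]
    exact h2
  have e4 : 1 / (p : ℝ) * Real.exp (-(3 * S / (2 * (p : ℝ) ^ 2)) * dioDelta p γ ^ 2)
      ≤ 1 / (p : ℝ) ^ 2 := by
    calc _ ≤ 1 / (p : ℝ) * (1 / p) := by gcongr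
      _ = 1 / (p : ℝ) ^ 2 := by ring
  have e5 : 6 / (p : ℝ) ^ 2 = 1 / (p : ℝ) ^ 2 + 2 / (p : ℝ) ^ 2 + 1 / (p : ℝ) ^ 2
      + 2 * (1 / (p : ℝ) ^ 2) := by ring
  unfold firstArg
  rw [e5]
  linarith

theorem secondArg_le {p : ℕ} {S γ u : ℝ} (hp : 1 ≤ p)
    (hδ : u * (p : ℝ) ^ 2 ≤ dioDelta p γ ^ 2 * S)
    (hu : 1 ≤ u) (h2 : (p : ℝ) ^ 2 * Real.exp (-(3 * S / 8)) ≤ 1) :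
    secondArg p S γ ≤ 6 / (p : ℝ) := by
  have hp1 : (1 : ℝ) ≤ p := by exact_mod_cast hp
  have hp0 : (0 : ℝ) < p := by linarith
  have e1 : Real.sqrt ((2 * Real.pi / 3) / (dioDelta p γ ^ 2 * S)) ≤ 2 / (p : ℝ) := by
    refine sqrt_div_sq_le hp0 (le_trans ?_ hδ)
    nlinarith [sq_nonneg (p : ℝ)]
  have e3 : Real.exp (-(3 * S / 8)) ≤ 1 / (p : ℝ) := by
    rw [le_div_iff₀ hp0, mul_comm]
    refine le_trans (mul_le_mul_of_nonneg_right ?_ (Real.exp_pos _).le) h2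
    nlinarith
  -- The last `1 / p` is slack: 5 would do, but 6 matches the constant for the first bound.
  have e5 : 6 / (p : ℝ) = 1 / (p : ℝ) + 2 / (p : ℝ) + 2 * (1 / (p : ℝ)) + 1 / p := by ring
  have e6 : 0 < 1 / (p : ℝ) := by positivity
  unfold secondArg
  rw [e5]
  linarith

theorem symRateAt_le_logb {K : ℕ} (hK : 1 ≤ K) (h : Fin K → ℝ) {p : ℕ} (hp : 1 ≤ p) (S : ℝ) :
    symRateAt h p S ≤ Real.logb 2 p := by
  have hp0 : (0 : ℝ) < p := by exact_mod_cast hp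
  refine (ciInf_le (Finite.bddBelow_range _) (⟨0, hK⟩ : Fin K)).trans
    ((min_le_right _ _).trans ?_)
  have := Real.logb_le_logb_of_le (b := 2) (by norm_num) (by positivity)
    (inv_le_secondArg p S (h ⟨0, hK⟩))
  rw [one_div, Real.logb_inv] at this
  linarith

/-- The square-root term of the first bound does not involve `p` and is at least `S^(-1/2)` because
`2π/3 ≥ 1`. Being uniform in `p`, this caps the maximum over primes. -/
theorem symRateAt_le_logb_snr {K : ℕ} (hK : 1 ≤ K) (h : Fin K → ℝ) (p : ℕ) {S : ℝ} (hS : 0 < S) :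
    symRateAt h p S ≤ 1 / 4 * Real.logb 2 S := by
  refine (ciInf_le (Finite.bddBelow_range _) (⟨0, hK⟩ : Fin K)).trans
    ((min_le_left _ _).trans ?_)
  have h1 : Real.sqrt (1 / S) ≤ firstArg p S (h ⟨0, hK⟩) := by
    refine le_trans (Real.sqrt_le_sqrt ?_) (sqrt_le_firstArg p S _)
    have := Real.pi_gt_three
    gcongr
    linarith
  have := Real.logb_le_logb_of_le (b := 2) (by norm_num) (by positivity) h1
  rw [Real.sqrt_eq_rpow, Real.logb_rpow_eq_mul_logb_of_pos (by positivity), one_div S,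
    Real.logb_inv] at this
  linarith

theorem logb_sub_le_symRateAt {K : ℕ} (hK : 1 ≤ K) (h : Fin K → ℝ) {p : ℕ} {S u : ℝ} (hp : 1 ≤ p)
    (hS : (p : ℝ) ^ 4 ≤ S) (hδ : ∀ j, u * (p : ℝ) ^ 2 ≤ dioDelta p (h j) ^ 2 * S)
    (h1 : (p : ℝ) * Real.exp (-u) ≤ 1) (hu : 1 ≤ u)
    (h2 : (p : ℝ) ^ 2 * Real.exp (-(3 * S / 8)) ≤ 1) :
    Real.logb 2 p - Real.logb 2 6 ≤ symRateAt h p S := by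
  have hp0 : (0 : ℝ) < p := by exact_mod_cast hp
  have : Nonempty (Fin K) := ⟨⟨0, hK⟩⟩
  have h6 : 0 < Real.logb 2 6 := Real.logb_pos (by norm_num) (by norm_num)
  refine le_ciInf fun j => le_min ?_ ?_
  · have := Real.logb_le_logb_of_le (b := 2) (by norm_num) (firstArg_pos _)
      (firstArg_le hp hS (hδ j) h1 (by linarith) h2)
    rw [Real.logb_div (by norm_num) (by positivity), Real.logb_pow] at this
    push_cast at this
    linarith
  · have := Real.logb_le_logb_of_le (b := 2) (by norm_num) (secondArg_pos _)
      (secondArg_le hp (hδ j) hu h2)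
    rw [Real.logb_div (by norm_num) (by positivity)] at this
    linarith

/-! ### Linear codes of large minimum distance -/

theorem card_smul_fiber {A B : Type*} [AddGroup A] [Fintype A] [AddGroup B] [Fintype B]
    [DecidableEq B] (f : A →+ B) (hf : Function.Surjective f) (b : B) :
    Fintype.card B * (Finset.univ.filter fun x => f x = b).card = Fintype.card A := by
  classical
  have h := Finset.card_eq_sum_card_fiberwise (f := f) (s := Finset.univ) (t := Finset.univ)
    (by simp)
  rw [← Finset.card_univ (α := A), h, Finset.sum_congr rfl fun y _ =>
    AddMonoidHom.card_fiber_eq_of_mem_range f (hf y) (hf b)]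
  simp

/-- `G ↦ w G` as an additive homomorphism. -/
def vecMulHom {p d n : ℕ} (w : Fin d → ZMod p) :
    Matrix (Fin d) (Fin n) (ZMod p) →+ (Fin n → ZMod p) where
  toFun G := Matrix.vecMul w G
  map_zero' := by simp
  map_add' _ _ := Matrix.vecMul_add _ _ _

/-- A matrix whose only nonzero row sits where `w` is nonzero already reaches every vector. With
equal fibres, a uniform `G` thus makes `w G` uniform. -/
theorem vecMulHom_surjective {p d n : ℕ} [Fact p.Prime] {w : Fin d → ZMod p} (hw : w ≠ 0) :
    Function.Surjective (vecMulHom (n := n) w) := by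
  obtain ⟨i, hi⟩ := Function.ne_iff.mp hw
  intro v
  refine ⟨fun k t => if k = i then (w i)⁻¹ * v t else 0, ?_⟩
  ext t
  have hi' : w i ≠ 0 := hi
  simp only [vecMulHom, AddMonoidHom.coe_mk, ZeroHom.coe_mk, Matrix.vecMul, dotProduct]
  simp [hi']

/-- There are at most `2^n` supports, each carrying at most `p^r` vectors. The crude factor `2^n`
costs one bit per symbol, negligible against `log p`. -/
theorem card_hammingNorm_le {p n r : ℕ} [Fact p.Prime] :
    (Finset.univ.filter fun v : Fin n → ZMod p => hammingNorm v ≤ r).card ≤ 2 ^ n * p ^ r := by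
  classical
  have hp : 0 < p := (Fact.out : p.Prime).pos
  have hsub : (Finset.univ.filter fun v : Fin n → ZMod p => hammingNorm v ≤ r) ⊆
      (Finset.univ.filter fun T : Finset (Fin n) => T.card ≤ r).biUnion fun T =>
        Fintype.piFinset fun t => if t ∈ T then Finset.univ else {0} := by
    intro v hv
    simp only [Finset.mem_filter, Finset.mem_univ, true_and] at hv
    refine Finset.mem_biUnion.mpr ⟨Finset.univ.filter fun t => v t ≠ 0, by simpa [hammingNorm] using hv, ?_⟩
    rw [Fintype.mem_piFinset]
    intro t
    by_cases h : v t = 0 <;> simp [h]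
  refine (Finset.card_le_card hsub).trans (Finset.card_biUnion_le.trans ?_)
  have h1 : ∀ T ∈ Finset.univ.filter fun T : Finset (Fin n) => T.card ≤ r,
      (Fintype.piFinset fun t => if t ∈ T then (Finset.univ : Finset (ZMod p)) else {0}).card
        ≤ p ^ r := by
    intro T hT
    rw [Fintype.card_piFinset]
    have : ∀ t, (if t ∈ T then (Finset.univ : Finset (ZMod p)) else {0}).card
        = if t ∈ T then p else 1 := by
      intro t
      split_ifs <;> simp [ZMod.card]
    simp only [this]
    rw [Finset.prod_ite_mem]
    simp only [Finset.univ_inter, Finset.prod_const]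
    exact Nat.pow_le_pow_right hp (by simpa using hT)
  refine (Finset.sum_le_card_nsmul _ _ _ h1).trans ?_
  rw [smul_eq_mul]
  gcongr
  refine (Finset.card_filter_le _ _).trans ?_
  simp

/-- The Gilbert–Varshamov bound for linear codes. -/
theorem exists_generator_hammingNorm_gt {p d n r : ℕ} [Fact p.Prime]
    (h : p ^ d * (2 ^ n * p ^ r) < p ^ n) :
    ∃ G : Matrix (Fin d) (Fin n) (ZMod p), ∀ w : Fin d → ZMod p, w ≠ 0 →
      r < hammingNorm (Matrix.vecMul w G) := by
  classical
  by_contra! hcon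
  have hp : 0 < p := (Fact.out : p.Prime).pos
  set B := Finset.univ.filter fun v : Fin n → ZMod p => hammingNorm v ≤ r with hB
  -- Union bound: if every matrix were bad, the fibres `{G | w G = v}` with `w ≠ 0` and `v` of low
  -- weight would cover all matrices, though each fibre is only a `p^(-n)` fraction of them.
  have hcov : (Finset.univ : Finset (Matrix (Fin d) (Fin n) (ZMod p))) ⊆
      (Finset.univ.filter fun w : Fin d → ZMod p => w ≠ 0).biUnion fun w => B.biUnion fun v =>
        Finset.univ.filter fun G => vecMulHom w G = v := by
    intro G _
    obtain ⟨w, hw, hle⟩ := hcon G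
    simp only [Finset.mem_biUnion, Finset.mem_filter, Finset.mem_univ, true_and]
    exact ⟨w, hw, Matrix.vecMul w G, by simpa [hB] using hle, rfl⟩
  set N := Fintype.card (Matrix (Fin d) (Fin n) (ZMod p)) with hN
  have hNpos : 0 < N := Fintype.card_pos
  have hB_card : B.card ≤ 2 ^ n * p ^ r := card_hammingNorm_le
  have hfib : ∀ w ∈ Finset.univ.filter (fun w : Fin d → ZMod p => w ≠ 0),
      p ^ n * (B.biUnion fun v => Finset.univ.filter fun G => vecMulHom (n := n) w G = v).card
        ≤ 2 ^ n * p ^ r * N := by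
    intro w hw
    have hw0 : w ≠ 0 := by simpa using hw
    calc p ^ n * (B.biUnion fun v => Finset.univ.filter fun G => vecMulHom (n := n) w G = v).card
        ≤ p ^ n * ∑ v ∈ B, (Finset.univ.filter fun G => vecMulHom (n := n) w G = v).card :=
          Nat.mul_le_mul_left _ Finset.card_biUnion_le
      _ = ∑ v ∈ B, N := by
          rw [Finset.mul_sum]
          refine Finset.sum_congr rfl fun v _ => ?_
          have := card_smul_fiber (vecMulHom (n := n) w) (vecMulHom_surjective hw0) v
          rw [← hN] at this
          simpa [ZMod.card] using this
      _ = B.card * N := by simp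
      _ ≤ _ := Nat.mul_le_mul_right _ hB_card
  have key : p ^ n * N ≤ p ^ d * (2 ^ n * p ^ r) * N := by
    calc p ^ n * N ≤ p ^ n * ∑ w ∈ Finset.univ.filter (fun w : Fin d → ZMod p => w ≠ 0),
          (B.biUnion fun v => Finset.univ.filter fun G => vecMulHom (n := n) w G = v).card := by
          refine Nat.mul_le_mul_left _ ?_
          rw [hN, ← Finset.card_univ]
          exact (Finset.card_le_card hcov).trans Finset.card_biUnion_le
      _ ≤ ∑ w ∈ Finset.univ.filter (fun w : Fin d → ZMod p => w ≠ 0), 2 ^ n * p ^ r * N := by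
          rw [Finset.mul_sum]
          exact Finset.sum_le_sum hfib
      _ ≤ p ^ d * (2 ^ n * p ^ r * N) := by
          rw [Finset.sum_const, smul_eq_mul]
          refine Nat.mul_le_mul_right _ ((Finset.card_filter_le _ _).trans ?_)
          simp [ZMod.card]
      _ = _ := by ring
  exact absurd (Nat.le_of_mul_le_mul_right key hNpos) (not_le.mpr h)

/-! ### Letters of the constellation and their power -/

theorem modBasic_eq_sub (x : ℝ) : ∃ m : ℤ, modBasic x = x - m * latL := by
  refine ⟨toIcoDiv latL_pos (-(latL / 2)) x, ?_⟩
  rw [← zsmul_eq_mul]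
  exact (self_sub_toIcoDiv_zsmul latL_pos _ x).symm

theorem modBasic_modBasic (x : ℝ) : modBasic (modBasic x) = modBasic x :=
  (toIcoMod_eq_self latL_pos).mpr (toIcoMod_mem_Ico latL_pos _ x)

theorem latL_sq : latL ^ 2 = 12 := Real.sq_sqrt (by norm_num)

theorem two_mul_abs_valMinAbs_lt {p : ℕ} [Fact p.Prime] (hodd : Odd p) (s : ZMod p) :
    2 * |s.valMinAbs| < p := by
  obtain ⟨h1, h2⟩ := ZMod.valMinAbs_mem_Ioc s
  obtain ⟨m, hm⟩ := hodd
  rcases abs_cases s.valMinAbs with ⟨h, -⟩ | ⟨h, -⟩ <;> rw [h] <;> omega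

/-- Oddness makes the constellation symmetric and keeps it off the endpoints `±L/2`. For `p = 2` the
letters are `0` and `-L/2`, of mean energy `3/2`. -/
theorem modBasic_letter {p : ℕ} [Fact p.Prime] (hodd : Odd p) (s : ZMod p) :
    modBasic (latL / (p : ℝ) * (s.val : ℝ)) = latL / (p : ℝ) * (s.valMinAbs : ℝ) := by
  have hp : (0 : ℝ) < p := by exact_mod_cast (Fact.out : p.Prime).pos
  have hL := latL_pos
  have h2 : 2 * |(s.valMinAbs : ℝ)| < p := by exact_mod_cast two_mul_abs_valMinAbs_lt hodd s
  refine (toIcoMod_eq_iff latL_pos).mpr ⟨?_, ?_⟩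
  · have h3 := abs_lt.mp (show |(s.valMinAbs : ℝ)| < p / 2 by linarith)
    have e : latL / 2 = latL / p * (p / 2) := by field_simp
    have hq : 0 < latL / p := by positivity
    constructor
    · rw [e]; nlinarith
    · rw [show -(latL / 2) + latL = latL / 2 by ring, e]; nlinarith
  · rw [ZMod.valMinAbs_def_pos]
    split_ifs with h
    · exact ⟨0, by simp⟩
    · refine ⟨1, ?_⟩
      push_cast
      rw [one_smul]
      field_simp
      ring

theorem twelve_mul_sum_valMinAbs_sq (m : ℕ) :
    12 * ∑ s : ZMod (2 * m + 1), s.valMinAbs ^ 2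
      = ((2 * m + 1 : ℕ) : ℤ) * (((2 * m + 1 : ℕ) : ℤ) ^ 2 - 1) := by
  have h1 : ∑ s : ZMod (2 * m + 1), s.valMinAbs ^ 2
      = ∑ i ∈ Finset.range (2 * m + 1),
        (if i ≤ m then (i : ℤ) else (i : ℤ) - (2 * m + 1 : ℕ)) ^ 2 := by
    rw [Finset.sum_range]
    refine Finset.sum_congr rfl fun s _ => ?_
    rw [ZMod.valMinAbs_def_pos]
    have : (2 * m + 1) / 2 = m := by omega
    rw [this]
    rfl
  have h2 : ∀ k : ℕ, 6 * ∑ i ∈ Finset.range (k + 1), (i : ℤ) ^ 2 = k * (k + 1) * (2 * k + 1) := by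
    intro k
    induction k with
    | zero => simp
    | succ k ih =>
      rw [Finset.sum_range_succ, mul_add, ih]
      push_cast
      ring
  -- The upper half of the representatives becomes `-m, …, -1`; reversing the order matches its
  -- squares with those of `1, …, m`.
  have h3 : ∑ i ∈ Finset.range m,
      (if m + 1 + i ≤ m then ((m + 1 + i : ℕ) : ℤ) else ((m + 1 + i : ℕ) : ℤ) - (2 * m + 1 : ℕ)) ^ 2
      = ∑ i ∈ Finset.range (m + 1), (i : ℤ) ^ 2 := by
    rw [Finset.sum_range_succ', ← Finset.sum_range_reflect]
    simp only [Nat.cast_zero, ne_eq, OfNat.ofNat_ne_zero, not_false_eq_true, zero_pow, add_zero]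
    refine Finset.sum_congr rfl fun i hi => ?_
    have hi' := Finset.mem_range.mp hi
    rw [if_neg (by omega)]
    have : ((m + 1 + (m - 1 - i) : ℕ) : ℤ) = 2 * m - i := by omega
    rw [this]
    push_cast
    ring
  rw [h1, show 2 * m + 1 = (m + 1) + m by ring, Finset.sum_range_add]
  have h4 : ∑ i ∈ Finset.range (m + 1),
      (if i ≤ m then (i : ℤ) else (i : ℤ) - ((m + 1) + m : ℕ)) ^ 2
      = ∑ i ∈ Finset.range (m + 1), (i : ℤ) ^ 2 := by
    refine Finset.sum_congr rfl fun i hi => ?_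
    rw [if_pos (by have := Finset.mem_range.mp hi; omega)]
  rw [show 2 * m + 1 = (m + 1) + m by ring] at h3
  rw [h3, h4]
  have := h2 m
  push_cast
  linear_combination 4 * this

/-- The average energy of a letter drawn uniformly from the constellation is at most one. -/
theorem sum_letter_sq_le {p : ℕ} [Fact p.Prime] (hodd : Odd p) :
    ∑ s : ZMod p, (latL / (p : ℝ) * (s.valMinAbs : ℝ)) ^ 2 ≤ p := by
  have hp : (0 : ℝ) < p := by exact_mod_cast (Fact.out : p.Prime).pos
  have h : 12 * ∑ s : ZMod p, s.valMinAbs ^ 2 = (p : ℤ) * ((p : ℤ) ^ 2 - 1) := by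
    obtain ⟨m, rfl⟩ := hodd
    convert twelve_mul_sum_valMinAbs_sq m
  have h' : 12 * ∑ s : ZMod p, (s.valMinAbs : ℝ) ^ 2 = (p : ℝ) * ((p : ℝ) ^ 2 - 1) := by
    exact_mod_cast h
  -- With `L² = 12` the sum equals `(p² - 1)/p`, just below `p`.
  simp_rw [mul_pow, ← Finset.mul_sum, div_pow, latL_sq]
  rw [div_mul_eq_mul_div, h', div_le_iff₀ (by positivity)]
  nlinarith

/-- Each coordinate of `w G` is a linear functional of `w`: either zero, or equidistributed on `ZMod
p`. So the power constraint holds for every `G`. -/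
theorem sum_letter_sq_hom_le {p d : ℕ} [Fact p.Prime] (hodd : Odd p)
    (φ : (Fin d → ZMod p) →ₗ[ZMod p] ZMod p) :
    ∑ w, (latL / (p : ℝ) * ((φ w).valMinAbs : ℝ)) ^ 2 ≤ (p : ℝ) ^ d := by
  classical
  have hp : (0 : ℝ) < p := by exact_mod_cast (Fact.out : p.Prime).pos
  by_cases hφ : φ = 0
  · simp only [hφ, LinearMap.zero_apply, ZMod.valMinAbs_zero, Int.cast_zero, mul_zero]
    simp only [ne_eq, OfNat.ofNat_ne_zero, not_false_eq_true, zero_pow, Finset.sum_const_zero]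
    positivity
  · have hs : Function.Surjective φ.toAddMonoidHom := LinearMap.surjective hφ
    rw [← Finset.sum_fiberwise (s := Finset.univ) (g := φ)]
    have hfib : ∀ s : ZMod p, ((Finset.univ.filter fun w => φ w = s).card : ℝ) = p ^ d / p := by
      intro s
      have h := card_smul_fiber φ.toAddMonoidHom hs s
      rw [eq_div_iff hp.ne', mul_comm]
      have h2 : p * (Finset.univ.filter fun w => φ w = s).card = p ^ d := by
        rw [ZMod.card, Fintype.card_pi_const, ZMod.card] at h
        convert h
        rfl
      exact_mod_cast h2
    calc ∑ s : ZMod p, ∑ w ∈ Finset.univ.filter (fun w => φ w = s),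
          (latL / (p : ℝ) * ((φ w).valMinAbs : ℝ)) ^ 2
        = ∑ s : ZMod p, (p : ℝ) ^ d / p * (latL / (p : ℝ) * (s.valMinAbs : ℝ)) ^ 2 := by
          refine Finset.sum_congr rfl fun s _ => ?_
          rw [← hfib s, ← nsmul_eq_mul, ← Finset.sum_const]
          refine Finset.sum_congr rfl fun w hw => ?_
          rw [(Finset.mem_filter.mp hw).2]
      _ ≤ (p : ℝ) ^ d / p * p := by
          rw [← Finset.mul_sum]
          exact mul_le_mul_of_nonneg_left (sum_letter_sq_le hodd) (by positivity)
      _ = _ := by field_simp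

theorem sum_linearCodeword_sq_le {p d n : ℕ} [Fact p.Prime] (hodd : Odd p)
    (G : Matrix (Fin d) (Fin n) (ZMod p)) :
    ∑ w, ∑ t, linearCodeword G w t ^ 2 ≤ (p : ℝ) ^ d * n := by
  rw [Finset.sum_comm]
  refine (Finset.sum_le_card_nsmul _ _ ((p : ℝ) ^ d) fun t _ => ?_).trans (le_of_eq ?_)
  · have := sum_letter_sq_hom_le hodd ((LinearMap.proj t).comp (Matrix.vecMulLinear G))
    refine le_trans (le_of_eq ?_) this
    refine Finset.sum_congr rfl fun w _ => ?_
    rw [linearCodeword, modBasic_letter hodd]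
    rfl
  · simp [mul_comm]

/-! ### Symbolwise decisions -/

/-- The received values that are closer than `r` to `(L/p) (γ s + b)` for some integer `b`. -/
def decisionRegion (p : ℕ) (γ r : ℝ) (s : ZMod p) : Set ℝ :=
  {x | ∃ b : ℤ, |x - latL / (p : ℝ) * (γ * (s.valMinAbs : ℝ) + b)| < r}

theorem measurableSet_decisionRegion (p : ℕ) (γ r : ℝ) (s : ZMod p) :
    MeasurableSet (decisionRegion p γ r s) := by
  have : decisionRegion p γ r s
      = ⋃ b : ℤ, {x | |x - latL / (p : ℝ) * (γ * (s.valMinAbs : ℝ) + b)| < r} := by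
    ext x
    simp [decisionRegion]
  rw [this]
  refine MeasurableSet.iUnion fun b => measurableSet_lt ?_ measurable_const
  fun_prop

/-- Centres for distinct letters differ by `(L/p)(l γ + m)` with `0 < |l| < p`, hence by at least
`(L/p) δ ≥ 2r`, while `x` would be strictly within `r` of both. -/
theorem decisionRegion_unique {p : ℕ} [Fact p.Prime] (hodd : Odd p) {γ r x : ℝ}
    (hr : 2 * r ≤ latL / (p : ℝ) * dioDelta p γ) {s s' : ZMod p}
    (h : x ∈ decisionRegion p γ r s) (h' : x ∈ decisionRegion p γ r s') : s = s' := by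
  by_contra hne
  obtain ⟨b, hb⟩ := h
  obtain ⟨b', hb'⟩ := h'
  have hp : (0 : ℝ) < p := by exact_mod_cast (Fact.out : p.Prime).pos
  have hq : 0 < latL / p := div_pos latL_pos hp
  have hl : s.valMinAbs - s'.valMinAbs ≠ 0 := by
    rw [sub_ne_zero]
    exact fun h => hne (ZMod.injective_valMinAbs h)
  have hlp : |s.valMinAbs - s'.valMinAbs| < p := by
    have h1 := two_mul_abs_valMinAbs_lt hodd s
    have h2 := two_mul_abs_valMinAbs_lt hodd s'
    have h3 := abs_sub s.valMinAbs s'.valMinAbs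
    omega
  have hδ := dioDelta_le_int hl hlp γ (b - b')
  have h1 := mul_le_mul_of_nonneg_left hδ hq.le
  nth_rewrite 2 [← abs_of_pos hq] at h1
  rw [← abs_mul] at h1
  have h2 := abs_sub_le (latL / (p : ℝ) * (γ * (s.valMinAbs : ℝ) + b)) x
    (latL / (p : ℝ) * (γ * (s'.valMinAbs : ℝ) + b'))
  rw [abs_sub_comm _ x] at h2
  have h3 : latL / (p : ℝ) * (((s.valMinAbs - s'.valMinAbs : ℤ) : ℝ) * γ + ((b - b' : ℤ) : ℝ))
      = latL / (p : ℝ) * (γ * (s.valMinAbs : ℝ) + b)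
        - latL / (p : ℝ) * (γ * (s'.valMinAbs : ℝ) + b') := by
    push_cast
    ring
  rw [h3] at h1
  linarith

open Classical in
/-- Bounded-distance decoding after symbolwise decisions. -/
theorem exists_measurable_decoder {n s : ℕ} {A W : Type*} [Finite W] [Nonempty W]
    [MeasurableSpace W] (N : A → Set ℝ) (hN : ∀ σ, MeasurableSet (N σ))
    (hdisj : ∀ x σ σ', x ∈ N σ → x ∈ N σ' → σ = σ') (cw : W → Fin n → A)
    (hdist : ∀ w w', w ≠ w' → 2 * s < (Finset.univ.filter fun t => cw w t ≠ cw w' t).card) :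
    ∃ D : (Fin n → ℝ) → W, Measurable D ∧
      ∀ y w, (Finset.univ.filter fun t => y t ∉ N (cw w t)).card ≤ s → D y = w := by
  have hmeas : ∀ w, MeasurableSet {y : Fin n → ℝ |
      (Finset.univ.filter fun t => y t ∉ N (cw w t)).card ≤ s} := by
    intro w
    simp_rw [Finset.card_filter]
    refine measurableSet_le (Finset.measurable_sum _ fun t _ => ?_) measurable_const
    exact Measurable.ite ((hN _).compl.preimage (measurable_pi_apply t)) measurable_const
      measurable_const
  obtain ⟨D, hD, hD'⟩ := exists_measurable_piecewise _ hmeas (fun w _ => w)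
    (fun w => measurable_const) (by
      intro w w' hne y hy
      exfalso
      -- Where two codewords differ, the regions are disjoint, so the received value is an error for
      -- at least one of them. At most `s` errors for each would give distance at most `2 * s`.
      have h1 : (Finset.univ.filter fun t => cw w t ≠ cw w' t) ⊆
          (Finset.univ.filter fun t => y t ∉ N (cw w t)) ∪
            (Finset.univ.filter fun t => y t ∉ N (cw w' t)) := by
        intro t ht
        simp only [Finset.mem_union, Finset.mem_filter, Finset.mem_univ, true_and] at ht ⊢
        by_contra! hcon
        exact ht (hdisj _ _ _ hcon.1 hcon.2)
      have h2 := (Finset.card_le_card h1).trans (Finset.card_union_le _ _)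
      have h3 := hdist w w' hne
      have h4 := hy.1
      have h5 := hy.2
      simp only [Set.mem_ofPred_eq] at h4 h5
      omega)
  exact ⟨D, hD, fun y w h => hD' w h⟩

/-! ### The noise -/

-- Union over the at most `2^n` position sets of size `k`; independence gives `μ(A)^k` for each.
open Classical in
theorem measureReal_pi_card_mem_ge_le {n k : ℕ} (μ : Measure ℝ) [IsProbabilityMeasure μ]
    (A : Set ℝ) :
    (Measure.pi fun _ : Fin n => μ).real {z | k ≤ (Finset.univ.filter fun t => z t ∈ A).card}
      ≤ 2 ^ n * μ.real A ^ k := by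
  have hsub : {z : Fin n → ℝ | k ≤ (Finset.univ.filter fun t => z t ∈ A).card} ⊆
      ⋃ T ∈ Finset.powersetCard k (Finset.univ : Finset (Fin n)),
        Set.univ.pi fun t => if t ∈ T then A else Set.univ := by
    intro z hz
    obtain ⟨T, hT, hcard⟩ := Finset.exists_subset_card_eq hz
    simp only [Set.mem_iUnion, Finset.mem_powersetCard]
    refine ⟨T, ⟨Finset.subset_univ _, hcard⟩, fun t _ => ?_⟩
    dsimp only
    split_ifs with h
    · exact (Finset.mem_filter.mp (hT h)).2
    · trivial
  have hbox : ∀ T ∈ Finset.powersetCard k (Finset.univ : Finset (Fin n)),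
      (Measure.pi fun _ : Fin n => μ).real (Set.univ.pi fun t => if t ∈ T then A else Set.univ)
        = μ.real A ^ k := by
    intro T hT
    rw [measureReal_def, Measure.pi_pi, ENNReal.toReal_prod]
    have : ∀ t, (μ (if t ∈ T then A else Set.univ)).toReal = if t ∈ T then μ.real A else 1 := by
      intro t
      split_ifs
      · rfl
      · simp
    simp only [this]
    rw [Finset.prod_ite_mem]
    simp [(Finset.mem_powersetCard.mp hT).2]
  refine (measureReal_mono hsub (measure_ne_top _ _)).trans
    ((measureReal_biUnion_finset_le _ _).trans ?_)
  rw [Finset.sum_congr rfl hbox, Finset.sum_const, nsmul_eq_mul]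
  refine mul_le_mul_of_nonneg_right ?_ (by positivity)
  rw [Finset.card_powersetCard, Finset.card_univ, Fintype.card_fin]
  exact_mod_cast Nat.choose_le_two_pow n k

/-- Chebyshev suffices: the symbol error only has to fall below a constant depending on `N`, as the
outer code makes the block error exponentially small. -/
theorem gaussianReal_abs_ge_le {S r : ℝ} (hS : 0 < S) (hr : 0 < r) :
    (gaussianReal 0 (Real.toNNReal (1 / S))).real {x | r ≤ |x|} ≤ 1 / (S * r ^ 2) := by
  have h := meas_ge_le_variance_div_sq (μ := gaussianReal 0 (Real.toNNReal (1 / S))) (X := id)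
    (memLp_id_gaussianReal 2) hr
  rw [variance_id_gaussianReal] at h
  simp only [id, integral_id_gaussianReal, sub_zero] at h
  have h2 := ENNReal.toReal_mono ENNReal.ofReal_ne_top h
  rw [ENNReal.toReal_ofReal (by positivity), Real.coe_toNNReal _ (by positivity)] at h2
  refine h2.trans (le_of_eq ?_)
  field_simp

/-! ### Lattice-alignment codes with bounded-distance decoding -/

/-- This is the alignment: integer gains keep the interference in `(L/p)ℤ`, and reduction subtracts
a multiple of `L = p (L/p)`. Both are absorbed in the integer of the decision region. -/
theorem modBasic_received_mem {K p : ℕ} (h : Fin K → ℝ) (a : Fin K → Fin K → ℤ)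
    (σ : Fin K → ZMod p) {r z : ℝ} (hz : |z| < r) (hp : 0 < p) (j : Fin K) :
    modBasic (∑ k, integerGains h a j k * (latL / (p : ℝ) * ((σ k).valMinAbs : ℝ)) + z)
      ∈ decisionRegion p (h j) r (σ j) := by
  obtain ⟨m, hm⟩ := modBasic_eq_sub
    (∑ k, integerGains h a j k * (latL / (p : ℝ) * ((σ k).valMinAbs : ℝ)) + z)
  have hp' : (p : ℝ) ≠ 0 := by exact_mod_cast hp.ne'
  refine ⟨∑ k ∈ Finset.univ.erase j, a j k * (σ k).valMinAbs - m * p, ?_⟩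
  rw [hm, ← Finset.add_sum_erase _ _ (Finset.mem_univ j)]
  have h1 : ∑ k ∈ Finset.univ.erase j,
      integerGains h a j k * (latL / (p : ℝ) * ((σ k).valMinAbs : ℝ))
      = latL / (p : ℝ) * ∑ k ∈ Finset.univ.erase j, (a j k : ℝ) * ((σ k).valMinAbs : ℝ) := by
    rw [Finset.mul_sum]
    refine Finset.sum_congr rfl fun k hk => ?_
    rw [integerGains, if_neg (Finset.ne_of_mem_erase hk).symm]
    ring
  rw [h1, integerGains, if_pos rfl]
  convert hz using 2
  push_cast
  field_simp
  ring

open Classical in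
theorem exists_code_errorProb_le {K n d p s : ℕ} [Fact p.Prime] (hodd : Odd p) (h : Fin K → ℝ)
    (a : Fin K → Fin K → ℤ) {r : Fin K → ℝ}
    (hr : ∀ j, 2 * r j ≤ latL / (p : ℝ) * dioDelta p (h j))
    (G : Matrix (Fin d) (Fin n) (ZMod p)) :
    ∃ c : ICCode K n, c.IsLatticeAlignment p d ∧
      ((∀ w : Fin d → ZMod p, w ≠ 0 → 2 * s < hammingNorm (Matrix.vecMul w G)) →
        ∀ S : ℝ, c.errorProb (integerGains h a) S ≤
          ∑ j, 2 ^ n * (gaussianReal 0 (Real.toNNReal (1 / S))).real {x | r j ≤ |x|} ^ (s + 1)) := by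
  have hp : 0 < p := (Fact.out : p.Prime).pos
  have hcard : Fintype.card (Fin d → ZMod p) = p ^ d := by simp [ZMod.card]
  let e : Fin (p ^ d) ≃ (Fin d → ZMod p) := (Fintype.equivFinOfCardEq hcard).symm
  have : NeZero (p ^ d) := ⟨(pow_pos hp d).ne'⟩
  have hD : ∀ j, ∃ D : (Fin n → ℝ) → Fin (p ^ d), Measurable D ∧
      ((∀ w : Fin d → ZMod p, w ≠ 0 → 2 * s < hammingNorm (Matrix.vecMul w G)) → ∀ y w,
      (Finset.univ.filter fun t => y t ∉
        decisionRegion p (h j) (r j) (Matrix.vecMul (e w) G t)).card ≤ s → D y = w) := by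
    intro j
    by_cases hG : ∀ w : Fin d → ZMod p, w ≠ 0 → 2 * s < hammingNorm (Matrix.vecMul w G)
    swap
    -- A generator of small distance gets a constant decoder, so that a code of the required form
    -- exists for every `G`.
    · exact ⟨fun _ => 0, measurable_const, fun h => absurd h hG⟩
    suffices hsuff : ∃ D : (Fin n → ℝ) → Fin (p ^ d), Measurable D ∧ ∀ y w,
        (Finset.univ.filter fun t => y t ∉
          decisionRegion p (h j) (r j) (Matrix.vecMul (e w) G t)).card ≤ s → D y = w by
      obtain ⟨D, hD, hD'⟩ := hsuff
      exact ⟨D, hD, fun _ => hD'⟩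
    refine exists_measurable_decoder (decisionRegion p (h j) (r j))
      (measurableSet_decisionRegion p (h j) (r j))
      (fun x σ σ' h1 h2 => decisionRegion_unique hodd (hr j) h1 h2)
      (fun w => Matrix.vecMul (e w) G) ?_
    intro w w' hne
    have := hG (e w - e w') (sub_ne_zero.mpr (e.injective.ne hne))
    rw [Matrix.sub_vecMul] at this
    simpa [hammingNorm, sub_ne_zero] using this
  choose D hDm hDc using hD
  have hmod : Measurable modBasic := by
    have : modBasic = fun x => x - (⌊(x - -(latL / 2)) / latL⌋ : ℝ) * latL := by
      ext x
      rw [modBasic, toIcoMod, toIcoDiv_eq_floor, zsmul_eq_mul]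
    rw [this]
    fun_prop
  let c : ICCode K n :=
    { M := fun _ => p ^ d
      enc := fun _ w => linearCodeword G (e w)
      dec := fun j y => D j fun t => modBasic (y t)
      measurable_dec := fun j => (hDm j).comp
        (measurable_pi_lambda _ fun t => hmod.comp (measurable_pi_apply t))
      power := fun k => by
        rw [e.sum_comp fun w => ∑ t, linearCodeword G w t ^ 2]
        push_cast
        exact sum_linearCodeword_sq_le hodd G }
  refine ⟨c, ⟨⟨G, fun _ => e, fun _ _ => rfl⟩, fun j y => ?_⟩, fun hG S => ?_⟩
  · change D j _ = D j _
    simp only [modBasic_modBasic]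
  set μ := gaussianReal 0 (Real.toNNReal (1 / S)) with hμ
  have hbound : ∀ w : (k : Fin K) → Fin (c.M k),
      (noiseLaw K n S).real {z | ∃ j, c.dec j (c.received (integerGains h a) w z j) ≠ w j}
        ≤ ∑ j, 2 ^ n * μ.real {x | r j ≤ |x|} ^ (s + 1) := by
    intro w
    have hsub : {z : Fin K → Fin n → ℝ |
        ∃ j, c.dec j (c.received (integerGains h a) w z j) ≠ w j} ⊆
        ⋃ j, Function.eval j ⁻¹' {z : Fin n → ℝ |
          s + 1 ≤ (Finset.univ.filter fun t => z t ∈ {x | r j ≤ |x|}).card} := by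
      rintro z ⟨j, hj⟩
      refine Set.mem_iUnion.mpr ⟨j, ?_⟩
      by_contra hcon
      refine hj (hDc j hG _ (w j) ?_)
      simp only [Set.mem_preimage, Set.mem_ofPred_eq, Function.eval, not_le] at hcon
      refine le_trans (Finset.card_le_card ?_) (Nat.lt_succ_iff.mp hcon)
      intro t ht
      simp only [Finset.mem_filter, Finset.mem_univ, true_and] at ht ⊢
      by_contra hlt
      refine ht ?_
      have h3 := modBasic_received_mem h a (fun k => Matrix.vecMul (e (w k)) G t)
        (not_le.mp hlt) hp j
      convert h3 using 2
      unfold ICCode.received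
      congr 1
      refine Finset.sum_congr rfl fun k _ => ?_
      rw [← modBasic_letter hodd]
      rfl
    refine (measureReal_mono hsub (by unfold noiseLaw; exact measure_ne_top _ _)).trans
      ((measureReal_iUnion_fintype_le _).trans (Finset.sum_le_sum fun j _ => ?_))
    have hmp := measurePreserving_eval (fun _ : Fin K => Measure.pi fun _ : Fin n => μ) j
    have hms : MeasurableSet {z : Fin n → ℝ |
        s + 1 ≤ (Finset.univ.filter fun t => z t ∈ {x | r j ≤ |x|}).card} := by
      simp_rw [Finset.card_filter]
      refine measurableSet_le measurable_const (Finset.measurable_sum _ fun t _ => ?_)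
      refine Measurable.ite ?_ measurable_const measurable_const
      exact measurableSet_le measurable_const (measurable_pi_apply t).abs
    have h1 := hmp.measureReal_preimage hms.nullMeasurableSet
    have h2 := measureReal_pi_card_mem_ge_le (n := n) (k := s + 1) μ {x | r j ≤ |x|}
    exact (le_of_eq h1).trans h2
  have hM : (0 : ℝ) < ∏ k, (c.M k : ℝ) :=
    Finset.prod_pos fun k _ => by exact_mod_cast pow_pos hp d
  unfold ICCode.errorProb
  rw [div_le_iff₀ hM]
  refine (Finset.sum_le_card_nsmul _ _ _ fun w _ => hbound w).trans (le_of_eq ?_)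
  rw [nsmul_eq_mul, Finset.card_univ, Fintype.card_pi, mul_comm]
  simp

/-! ### Asymptotics of the rate -/

theorem eventually_mul_exp_neg_le {c : ℝ} (hc : 0 < c) {b : ℝ} (hb : 0 < b) :
    ∀ᶠ S : ℝ in atTop, S * Real.exp (-(b * S)) ≤ c := by
  have h := tendsto_rpow_mul_exp_neg_mul_atTop_nhds_zero 1 b hb
  filter_upwards [h.eventually_le_const hc] with S hS
  simpa [Real.rpow_one] using hS

theorem eventually_mul_exp_neg_rpow_le {ε : ℝ} (hε : 0 < ε) :
    ∀ᶠ S : ℝ in atTop, S * Real.exp (-S ^ ε) ≤ 1 := by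
  have h := (tendsto_rpow_mul_exp_neg_mul_atTop_nhds_zero (1 / ε) 1 one_pos).comp
    (tendsto_rpow_atTop hε)
  filter_upwards [h.eventually_le_const one_pos, eventually_gt_atTop 0] with S hS hS0
  simp only [Function.comp] at hS
  rw [← Real.rpow_mul hS0.le, mul_one_div_cancel hε.ne', Real.rpow_one] at hS
  simpa using hS

theorem sq_le_of_pow_four_le {p : ℕ} {S : ℝ} (hp : 1 ≤ p) (h : (p : ℝ) ^ 4 ≤ S) :
    (p : ℝ) ≤ S ∧ (p : ℝ) ^ 2 ≤ S := by
  have hp1 : (1 : ℝ) ≤ p := by exact_mod_cast hp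
  constructor
  · exact (by simpa using pow_le_pow_right₀ hp1 (show 1 ≤ 4 by norm_num) : (p : ℝ) ≤ p ^ 4).trans h
  · exact (pow_le_pow_right₀ hp1 (by norm_num)).trans h

/-- Since `p² ≤ √S`, the exponent is at most a negative constant times `√S`, uniformly in `p`. The
left side is then below `1/4` and the right side at least `1/2`. -/
theorem eventually_mem_admissiblePrimes {γ : ℝ} (hγ : modQuarter γ ≠ 0) :
    ∀ᶠ S : ℝ in atTop, ∀ p : ℕ, p.Prime → (p : ℝ) ^ 4 ≤ S → p ∈ admissiblePrimes S γ := by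
  have hγ2 : 0 < modQuarter γ ^ 2 := by positivity
  have h1 : Tendsto (fun S : ℝ => Real.exp (-(3 / 2 * modQuarter γ ^ 2 * S ^ (1 / 2 : ℝ)))) atTop
      (𝓝 0) := by
    refine Real.tendsto_exp_neg_atTop_nhds_zero.comp ?_
    exact (tendsto_rpow_atTop (by norm_num)).const_mul_atTop (by positivity)
  filter_upwards [h1.eventually_lt_const (show (0 : ℝ) < 1 / 4 by norm_num),
    eventually_mul_exp_neg_le (show (0 : ℝ) < 1 / 4 by norm_num) (show (0 : ℝ) < 3 / 8 by norm_num),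
    eventually_gt_atTop 0] with S hS1 hS2 hS0 p hp hp4
  have hp0 : (0 : ℝ) < p := by exact_mod_cast hp.pos
  refine ⟨hp, ?_⟩
  have h2 : Real.exp (-(3 * S / (2 * (p : ℝ) ^ 2)) * modQuarter γ ^ 2) < 1 / 4 := by
    refine lt_of_le_of_lt (Real.exp_le_exp.mpr ?_) hS1
    have h3 : S ^ (1 / 2 : ℝ) ≤ S / (p : ℝ) ^ 2 := by
      rw [← Real.sqrt_eq_rpow, le_div_iff₀ (by positivity)]
      have h4 : (p : ℝ) ^ 2 ≤ Real.sqrt S := Real.le_sqrt_of_sq_le (by rw [← pow_mul]; exact hp4)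
      have h5 := Real.mul_self_sqrt hS0.le
      nlinarith [Real.sqrt_nonneg S]
    have h4 : -(3 * S / (2 * (p : ℝ) ^ 2)) * modQuarter γ ^ 2
        = -(3 / 2 * modQuarter γ ^ 2 * (S / (p : ℝ) ^ 2)) := by field_simp
    rw [h4]
    exact neg_le_neg (mul_le_mul_of_nonneg_left h3 (by positivity))
  have h3 : (p : ℝ) * Real.exp (-(3 * S / 8)) ≤ 1 / 4 := by
    refine le_trans (mul_le_mul_of_nonneg_right (sq_le_of_pow_four_le hp.one_le hp4).1
      (Real.exp_pos _).le) ?_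
    rw [show 3 * S / 8 = 3 / 8 * S by ring]
    exact hS2
  linarith

theorem eventually_logb_sub_le_symRateAt {K : ℕ} (hK : 1 ≤ K) (h : Fin K → ℝ) {ε : ℝ}
    (hε : 0 < ε) :
    ∀ᶠ S : ℝ in atTop, ∀ p : ℕ, 1 ≤ p → (p : ℝ) ^ 4 ≤ S →
      (∀ j, S ^ ε * (p : ℝ) ^ 2 ≤ dioDelta p (h j) ^ 2 * S) →
      Real.logb 2 p - Real.logb 2 6 ≤ symRateAt h p S := by
  filter_upwards [eventually_mul_exp_neg_rpow_le hε,
    eventually_mul_exp_neg_le one_pos (show (0 : ℝ) < 3 / 8 by norm_num),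
    eventually_ge_atTop 1] with S h1 h2 hS p hp hp4 hδ
  obtain ⟨h3, h4⟩ := sq_le_of_pow_four_le hp hp4
  refine logb_sub_le_symRateAt hK h hp hp4 hδ ?_ (Real.one_le_rpow hS hε.le) ?_
  · exact (mul_le_mul_of_nonneg_right h3 (Real.exp_pos _).le).trans h1
  · rw [show 3 * S / 8 = 3 / 8 * S by ring]
    exact (mul_le_mul_of_nonneg_right h4 (Real.exp_pos _).le).trans h2

/-- Primes that are a fixed power below `S^{1/4}` keep the constellation well separated. -/
theorem DiophantineGain.eventually_separation {γ : ℝ} (hγ : DiophantineGain γ) {ε c : ℝ}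
    (hε : 0 < ε) (hc : 0 < c) :
    ∀ᶠ S : ℝ in atTop, ∀ p : ℕ, S ^ c ≤ p → (p : ℝ) ≤ S ^ (1 / 4 - ε / 2) →
      S ^ ε * (p : ℝ) ^ 2 ≤ dioDelta p γ ^ 2 * S := by
  -- The lower bound `S^c ≤ p` serves only to push `p` past this threshold.
  obtain ⟨N, hN⟩ := eventually_atTop.mp (hγ.2 ε hε)
  filter_upwards [(tendsto_rpow_atTop hc).eventually_ge_atTop (N : ℝ), eventually_ge_atTop 1]
    with S hSN hS p hp1 hp2
  have hS0 : 0 < S := by linarith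
  have hp0 : (0 : ℝ) < p := (Real.rpow_pos_of_pos hS0 c).trans_le hp1
  have hδ := hN p (by exact_mod_cast hSN.trans hp1)
  -- The exponents work because `(1/4 - ε/2)(4 + 2ε) = 1 - 3ε/2 - ε² ≤ 1 - ε`.
  have h1 : (p : ℝ) ^ (4 + 2 * ε) ≤ S ^ (1 - ε) := by
    refine (Real.rpow_le_rpow hp0.le hp2 (by linarith)).trans ?_
    rw [← Real.rpow_mul hS0.le]
    exact Real.rpow_le_rpow_of_exponent_le hS (by nlinarith)
  have h2 : ((p : ℝ) ^ (-1 - ε)) ^ 2 ≤ dioDelta p γ ^ 2 :=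
    pow_le_pow_left₀ (Real.rpow_nonneg hp0.le _) hδ 2
  have h3 : (p : ℝ) ^ 2 = (p : ℝ) ^ (4 + 2 * ε) * ((p : ℝ) ^ (-1 - ε)) ^ 2 := by
    rw [← Real.rpow_natCast (_ ^ _), ← Real.rpow_mul hp0.le, ← Real.rpow_add hp0,
      ← Real.rpow_natCast]
    congr 1
    push_cast
    ring
  have h4 : S = S ^ ε * S ^ (1 - ε) := by
    rw [← Real.rpow_add hS0]
    simp
  calc S ^ ε * (p : ℝ) ^ 2 = S ^ ε * (p : ℝ) ^ (4 + 2 * ε) * ((p : ℝ) ^ (-1 - ε)) ^ 2 := by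
        rw [h3]; ring
    _ ≤ S ^ ε * S ^ (1 - ε) * dioDelta p γ ^ 2 := by gcongr
    _ = dioDelta p γ ^ 2 * S := by rw [← h4]; ring

section
variable {K : ℕ} {h : Fin K → ℝ} {ε : ℝ} {p : ℝ → ℕ} {e : ℝ → ℝ}

theorem eventually_prime_separation (hh : ∀ j, DiophantineGain (h j)) (hε : 0 < ε)
    (hε4 : ε < 1 / 4)
    (hp : ∀ᶠ S : ℝ in atTop, (p S).Prime ∧ (p S : ℝ) = S ^ (1 / 4 - e S))
    (he : Tendsto e atTop (𝓝 ε)) :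
    ∀ᶠ S : ℝ in atTop, S ^ ((1 / 4 - ε) / 2) ≤ p S ∧ (p S : ℝ) ^ 4 ≤ S ∧
      ∀ j, S ^ ε * (p S : ℝ) ^ 2 ≤ dioDelta (p S) (h j) ^ 2 * S := by
  have hsep := eventually_all.mpr fun j =>
    (hh j).eventually_separation hε (show 0 < (1 / 4 - ε) / 2 by linarith)
  filter_upwards [hp, he.eventually_const_le (show ε / 2 < ε by linarith),
    he.eventually_le_const (show ε < ε + (1 / 4 - ε) / 2 by linarith), hsep,
    eventually_ge_atTop 1] with S hpS he1 he2 hsepS hS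
  have h1 : S ^ ((1 / 4 - ε) / 2) ≤ p S := by
    rw [hpS.2]
    exact Real.rpow_le_rpow_of_exponent_le hS (by linarith)
  have h2 : (p S : ℝ) ≤ S ^ (1 / 4 - ε / 2) := by
    rw [hpS.2]
    exact Real.rpow_le_rpow_of_exponent_le hS (by linarith)
  refine ⟨h1, ?_, fun j => hsepS j _ h1 h2⟩
  rw [hpS.2, ← Real.rpow_natCast, ← Real.rpow_mul (by linarith)]
  refine (Real.rpow_le_rpow_of_exponent_le hS ?_).trans_eq (Real.rpow_one S)
  push_cast
  linarith

theorem eventually_forall_mem_admissiblePrimes (hh : ∀ j, DiophantineGain (h j)) (hε : 0 < ε)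
    (hε4 : ε < 1 / 4)
    (hp : ∀ᶠ S : ℝ in atTop, (p S).Prime ∧ (p S : ℝ) = S ^ (1 / 4 - e S))
    (he : Tendsto e atTop (𝓝 ε)) :
    ∀ᶠ S : ℝ in atTop, ∀ j, p S ∈ admissiblePrimes S (h j) := by
  filter_upwards [hp, eventually_prime_separation hh hε hε4 hp he, eventually_all.mpr fun j =>
    eventually_mem_admissiblePrimes (hh j).1.modQuarter_ne_zero] with S h1 h2 h3 j
  exact h3 j _ h1.1 h2.2.1

/-- The rate is squeezed between `log p - log 6` and `log p`, where `log p = (1/4 - e(S)) log S`. -/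
theorem tendsto_symRateAt_div (hK : 1 ≤ K) (hh : ∀ j, DiophantineGain (h j)) (hε : 0 < ε)
    (hε4 : ε < 1 / 4)
    (hp : ∀ᶠ S : ℝ in atTop, (p S).Prime ∧ (p S : ℝ) = S ^ (1 / 4 - e S))
    (he : Tendsto e atTop (𝓝 ε)) :
    Tendsto (fun S : ℝ => symRateAt h (p S) S / (1 / 4 * Real.logb 2 S)) atTop
      (𝓝 (1 - 4 * ε)) := by
  have hlog : Tendsto (fun S : ℝ => Real.logb 2 S) atTop atTop :=
    Real.tendsto_logb_atTop (by norm_num)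
  have hup : Tendsto (fun S => 1 - 4 * e S) atTop (𝓝 (1 - 4 * ε)) := (he.const_mul 4).const_sub 1
  have hlow : Tendsto (fun S => 1 - 4 * e S - 4 * Real.logb 2 6 / Real.logb 2 S) atTop
      (𝓝 (1 - 4 * ε)) := by
    simpa using hup.sub (hlog.const_div_atTop (4 * Real.logb 2 6))
  have hval : ∀ᶠ S : ℝ in atTop, 0 < Real.logb 2 S ∧
      Real.logb 2 (p S) = (1 / 4 - e S) * Real.logb 2 S := by
    filter_upwards [hp, hlog.eventually_gt_atTop 0, eventually_gt_atTop 0] with S h1 h2 h3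
    refine ⟨h2, ?_⟩
    rw [h1.2, Real.logb_rpow_eq_mul_logb_of_pos h3]
  refine tendsto_of_tendsto_of_tendsto_of_le_of_le' hlow hup ?_ ?_
  · filter_upwards [hp, hval, eventually_prime_separation hh hε hε4 hp he,
      eventually_logb_sub_le_symRateAt hK h hε] with S h1 h2 h3 h4
    have h5 := h4 _ h1.1.one_le h3.2.1 h3.2.2
    have h6 := h2.1
    rw [h2.2] at h5
    rw [le_div_iff₀ (by positivity)]
    refine le_trans (le_of_eq ?_) h5
    field_simp
  · filter_upwards [hp, hval] with S h1 h2
    have h5 := symRateAt_le_logb hK h h1.1.one_le S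
    have h6 := h2.1
    rw [h2.2] at h5
    rw [div_le_iff₀ (by positivity)]
    linarith

end

/-- Bertrand's postulate puts a prime between `x = S^(1/4-ε)` and `2⌈x⌉ ≤ 4x`, using `x ≥ 1`. The
factor 4 moves the exponent by at most `log 4 / log S`. -/
theorem exists_primes_rpow {ε : ℝ} (hε4 : ε < 1 / 4) :
    ∃ (p : ℝ → ℕ) (e : ℝ → ℝ), (∀ S, e S = 1 / 4 - Real.logb S (p S)) ∧
      (∀ᶠ S : ℝ in atTop, (p S).Prime ∧ (p S : ℝ) = S ^ (1 / 4 - e S)) ∧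
      Tendsto e atTop (𝓝 ε) := by
  have hex : ∀ S : ℝ, ∃ p : ℕ, 1 ≤ S → p.Prime ∧ S ^ (1 / 4 - ε) ≤ p ∧
      (p : ℝ) ≤ 4 * S ^ (1 / 4 - ε) := by
    intro S
    by_cases hS : 1 ≤ S
    · have h1 : 1 ≤ S ^ (1 / 4 - ε) := Real.one_le_rpow hS (by linarith)
      have h0 : 0 < ⌈S ^ (1 / 4 - ε)⌉₊ := Nat.ceil_pos.mpr (by linarith)
      obtain ⟨p, hp, hp1, hp2⟩ := Nat.exists_prime_lt_and_le_two_mul _ h0.ne'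
      refine ⟨p, fun _ => ⟨hp, (Nat.le_ceil _).trans (by exact_mod_cast hp1.le), ?_⟩⟩
      have h3 := Nat.ceil_lt_add_one (show 0 ≤ S ^ (1 / 4 - ε) by linarith)
      have h4 : (p : ℝ) ≤ 2 * ⌈S ^ (1 / 4 - ε)⌉₊ := by exact_mod_cast hp2
      linarith
    · exact ⟨2, fun h => absurd h hS⟩
  choose p hp using hex
  refine ⟨p, fun S => 1 / 4 - Real.logb S (p S), fun _ => rfl, ?_, ?_⟩
  · filter_upwards [eventually_gt_atTop 1] with S hS
    obtain ⟨h1, -, -⟩ := hp S hS.le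
    refine ⟨h1, ?_⟩
    rw [sub_sub_cancel, Real.rpow_logb (by linarith) hS.ne' (by exact_mod_cast h1.pos)]
  · have hl : Tendsto (fun S : ℝ => ε - Real.log 4 / Real.log S) atTop (𝓝 ε) := by
      simpa using (Real.tendsto_log_atTop.const_div_atTop (Real.log 4)).const_sub ε
    refine tendsto_of_tendsto_of_tendsto_of_le_of_le' hl tendsto_const_nhds ?_ ?_
    · filter_upwards [eventually_gt_atTop 1] with S hS
      obtain ⟨h1, -, h3⟩ := hp S hS.le
      have hS0 : 0 < S := by linarith
      have hlog := Real.log_pos hS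
      have h4 := Real.log_le_log (by exact_mod_cast h1.pos) h3
      rw [Real.log_mul (by norm_num) (by positivity), Real.log_rpow hS0] at h4
      have h5 : Real.logb S (p S) ≤ Real.log 4 / Real.log S + (1 / 4 - ε) := by
        rw [Real.logb, div_add' _ _ _ hlog.ne']
        gcongr
      linarith
    · filter_upwards [eventually_gt_atTop 1] with S hS
      obtain ⟨h1, h2, -⟩ := hp S hS.le
      have hS0 : 0 < S := by linarith
      have h4 := Real.logb_le_logb_of_le hS (by positivity) h2
      rw [Real.logb_rpow hS0 hS.ne'] at h4
      linarith

/-! ### The maximal symmetric rate -/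

section
variable {K : ℕ} {h : Fin K → ℝ}

/-- The right side of the admissibility condition must be positive, which forces `p < exp(3S/8)`. -/
theorem finite_symRateValues (hK : 1 ≤ K) (h : Fin K → ℝ) (S : ℝ) :
    (symRateValues h S).Finite := by
  refine ((Set.finite_Iio ⌈Real.exp (3 * S / 8)⌉₊).image fun p => symRateAt h p S).subset ?_
  rintro r ⟨p, hp, -, rfl⟩
  refine ⟨p, Nat.lt_ceil.mpr ?_, rfl⟩
  have h1 := (hp ⟨0, hK⟩).2
  have h2 := Real.exp_pos (-(3 * S / (2 * (p : ℝ) ^ 2)) * modQuarter (h ⟨0, hK⟩) ^ 2)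
  have h3 : (p : ℝ) * Real.exp (-(3 * S / 8)) < 1 := by nlinarith [Real.exp_pos (-(3 * S / 8))]
  rw [Real.exp_neg, ← div_eq_mul_inv, div_lt_one (Real.exp_pos _)] at h3
  exact h3

theorem eventually_symRateAt_mem (hh : ∀ j, DiophantineGain (h j)) {ε : ℝ} (hε : 0 < ε)
    (hε4 : ε < 1 / 4) {p : ℝ → ℕ} {e : ℝ → ℝ}
    (hp : ∀ᶠ S : ℝ in atTop, (p S).Prime ∧ (p S : ℝ) = S ^ (1 / 4 - e S))
    (he : Tendsto e atTop (𝓝 ε)) :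
    ∀ᶠ S : ℝ in atTop, symRateAt h (p S) S ∈ symRateValues h S := by
  filter_upwards [hp, eventually_forall_mem_admissiblePrimes hh hε hε4 hp he] with S h1 h2
  exact ⟨p S, h2, fun j => (hh j).1.dioDelta_pos h1.1.two_le, rfl⟩

theorem eventually_isGreatest_symRate (hK : 1 ≤ K) (hh : ∀ j, DiophantineGain (h j)) :
    ∀ᶠ S : ℝ in atTop, IsGreatest (symRateValues h S) (symRate h S) := by
  -- Any exponent in `(0, 1/4)` would do; it only shows that the set of values is nonempty.
  obtain ⟨p, e, -, hp, he⟩ := exists_primes_rpow (show (1 / 8 : ℝ) < 1 / 4 by norm_num)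
  filter_upwards [eventually_symRateAt_mem hh (by norm_num) (by norm_num) hp he] with S hS
  have hfin := finite_symRateValues hK h S
  exact ⟨Set.Nonempty.csSup_mem ⟨_, hS⟩ hfin, fun r hr => le_csSup hfin.bddAbove hr⟩

theorem tendsto_symRate_div (hK : 1 ≤ K) (hh : ∀ j, DiophantineGain (h j)) :
    Tendsto (fun S : ℝ => symRate h S / (1 / 4 * Real.logb 2 S)) atTop (𝓝 1) := by
  have hlog : Tendsto (fun S : ℝ => Real.logb 2 S) atTop atTop :=
    Real.tendsto_logb_atTop (by norm_num)
  refine tendsto_order.mpr ⟨fun b hb => ?_, fun b hb => ?_⟩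
  · obtain ⟨ε, hε, hε2⟩ := exists_between (show 0 < min (1 / 4) ((1 - b) / 4) by
      exact lt_min (by norm_num) (by linarith))
    have hε4 := hε2.trans_le (min_le_left _ _)
    have hεb := hε2.trans_le (min_le_right _ _)
    obtain ⟨p, e, -, hp, he⟩ := exists_primes_rpow hε4
    filter_upwards [eventually_symRateAt_mem hh hε hε4 hp he,
      (tendsto_symRateAt_div hK hh hε hε4 hp he).eventually_const_lt
        (show b < 1 - 4 * ε by linarith), hlog.eventually_gt_atTop 0] with S h1 h2 h3
    refine h2.trans_le ?_
    gcongr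
    exact le_csSup (finite_symRateValues hK h S).bddAbove h1
  · filter_upwards [eventually_isGreatest_symRate hK hh, hlog.eventually_gt_atTop 0,
      eventually_gt_atTop 0] with S h1 h2 h3
    refine lt_of_le_of_lt ?_ hb
    obtain ⟨p, -, -, hr⟩ := h1.1
    rw [div_le_one (by positivity), hr]
    exact symRateAt_le_logb_snr hK h p h3

end

/-! ### Existence of good codes -/

/-- Per symbol and in bits, the three factors on the left cost at most `R`, `1` and `(log p)/N`. -/
theorem pow_mul_lt_of_rate_lt {p n N : ℕ} (hp : 2 ≤ p) (hn : 1 ≤ n) {R : ℝ} (hR : 0 ≤ R)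
    (h : R + 1 + Real.logb 2 p / N < Real.logb 2 p) :
    p ^ ⌊(n : ℝ) * R / Real.logb 2 p⌋₊ * (2 ^ n * p ^ (2 * (n / (2 * N)))) < p ^ n := by
  have hp0 : (0 : ℝ) < p := by exact_mod_cast (by omega : 0 < p)
  have hl : 0 < Real.logb 2 p := Real.logb_pos (by norm_num) (by exact_mod_cast hp)
  have hn0 : (0 : ℝ) < n := by exact_mod_cast hn
  have h1 : (⌊(n : ℝ) * R / Real.logb 2 p⌋₊ : ℝ) * Real.logb 2 p ≤ n * R := by
    rw [← le_div_iff₀ hl]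
    exact Nat.floor_le (by positivity)
  have h2 : ((2 * (n / (2 * N)) : ℕ) : ℝ) ≤ n / N := by
    have : 2 * (n / (2 * N)) ≤ n / N := by
      rw [← Nat.div_div_eq_div_mul, Nat.div_right_comm]
      exact Nat.mul_div_le _ _
    exact (Nat.cast_le.mpr this).trans Nat.cast_div_le
  have h3 : Real.logb 2 ((p : ℝ) ^ ⌊(n : ℝ) * R / Real.logb 2 p⌋₊ *
      (2 ^ n * (p : ℝ) ^ (2 * (n / (2 * N))))) < Real.logb 2 ((p : ℝ) ^ n) := by
    rw [Real.logb_mul (by positivity) (by positivity),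
      Real.logb_mul (by positivity) (by positivity), Real.logb_pow, Real.logb_pow, Real.logb_pow,
      Real.logb_pow, Real.logb_self_eq_one (by norm_num)]
    have h4 := mul_le_mul_of_nonneg_right h2 hl.le
    have h5 := mul_lt_mul_of_pos_left h hn0
    have h6 : (n : ℝ) / N * Real.logb 2 p = n * (Real.logb 2 p / N) := by ring
    linarith
  have h4 := (Real.logb_lt_logb_iff (by norm_num) (by positivity) (by positivity)).mp h3
  exact_mod_cast h4

/-- The assumptions stand behind the existential so that a code of the right form is available for
every `n` and `S`, even where no error bound is claimed. -/
theorem exists_latticeAlignment_errorProb_le {K p : ℕ} [Fact p.Prime] (hodd : Odd p) (N : ℕ)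
    (hN : 1 ≤ N) (h : Fin K → ℝ) (a : Fin K → Fin K → ℤ) (R : ℝ) (n : ℕ) :
    ∃ c : ICCode K n, c.IsLatticeAlignment p ⌊(n : ℝ) * R / Real.logb 2 p⌋₊ ∧
      (1 ≤ n → 0 ≤ R → R + 1 + Real.logb 2 p / N < Real.logb 2 p →
        ∀ S : ℝ, 0 < S → (∀ j, 0 < dioDelta p (h j)) →
          (∀ j, 1 / (S * (latL / (2 * p) * dioDelta p (h j)) ^ 2) ≤ (1 / 4) ^ (2 * N)) →
          c.errorProb (integerGains h a) S ≤ K * (1 / 2) ^ n) := by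
  have hp : 0 < p := (Fact.out : p.Prime).pos
  have hp' : (0 : ℝ) < p := by exact_mod_cast hp
  set d := ⌊(n : ℝ) * R / Real.logb 2 p⌋₊ with hd
  set s := n / (2 * N) with hs
  obtain ⟨G, hG⟩ : ∃ G : Matrix (Fin d) (Fin n) (ZMod p), p ^ d * (2 ^ n * p ^ (2 * s)) < p ^ n →
      ∀ w : Fin d → ZMod p, w ≠ 0 → 2 * s < hammingNorm (Matrix.vecMul w G) := by
    by_cases hlt : p ^ d * (2 ^ n * p ^ (2 * s)) < p ^ n
    · obtain ⟨G, hG⟩ := exists_generator_hammingNorm_gt hlt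
      exact ⟨G, fun _ => hG⟩
    · exact ⟨0, fun h => absurd h hlt⟩
  obtain ⟨c, hc, herr⟩ := exists_code_errorProb_le (s := s) hodd h a
    (r := fun j => latL / (2 * p) * dioDelta p (h j))
    (fun j => le_of_eq (by field_simp)) G
  refine ⟨c, hc, fun hn hR hrate S hS hδ hq => ?_⟩
  have hlt := pow_mul_lt_of_rate_lt (Fact.out : p.Prime).two_le hn hR hrate
  refine (herr (hG hlt) S).trans ?_
  have hterm : ∀ j ∈ (Finset.univ : Finset (Fin K)),
      2 ^ n * (gaussianReal 0 (Real.toNNReal (1 / S))).real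
        {x | latL / (2 * p) * dioDelta p (h j) ≤ |x|} ^ (s + 1) ≤ (1 / 2 : ℝ) ^ n := by
    intro j _
    have hr : 0 < latL / (2 * p) * dioDelta p (h j) :=
      mul_pos (div_pos latL_pos (by positivity)) (hδ j)
    have h1 := (gaussianReal_abs_ge_le hS hr).trans (hq j)
    -- With `s = ⌊n/(2N)⌋`, the `s + 1` symbol errors of probability `4^(-2N)` outweigh the `2^n`
    -- position sets: `2^n 4^(-n) = 2^(-n)`.
    have h2 : n ≤ 2 * N * (s + 1) := (Nat.lt_mul_div_succ n (by omega)).le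
    calc _ ≤ 2 ^ n * (((1 / 4 : ℝ) ^ (2 * N)) ^ (s + 1)) := by gcongr
      _ ≤ 2 ^ n * (1 / 4 : ℝ) ^ n := by
          rw [← pow_mul]
          exact mul_le_mul_of_nonneg_left
            (pow_le_pow_of_le_one (by norm_num) (by norm_num) h2) (by positivity)
      _ = (1 / 2 : ℝ) ^ n := by rw [← mul_pow]; norm_num
  refine (Finset.sum_le_card_nsmul _ _ _ hterm).trans (le_of_eq ?_)
  simp

/-! ### Achievable rates of lattice-alignment codes -/

theorem ICCode.IsLatticeAlignment.card_messages {K n p d : ℕ} [NeZero p] {c : ICCode K n}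
    (hc : c.IsLatticeAlignment p d) (k : Fin K) : c.M k = p ^ d := by
  obtain ⟨⟨G, e, -⟩, -⟩ := hc
  simpa [ZMod.card] using Fintype.card_congr (e k)

/-- Pure counting: user `k` has at most `2^(nR)` messages, so no converse coding theorem is needed.
-/
theorem le_of_mem_achievableRates {K p : ℕ} (hp : 2 ≤ p) {H : Fin K → Fin K → ℝ} {S R : ℝ}
    (hR : 0 ≤ R) {c : (n : ℕ) → ICCode K n}
    (hc : ∀ n : ℕ, (c n).IsLatticeAlignment p ⌊(n : ℝ) * R / Real.logb 2 p⌋₊)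
    {R' : Fin K → ℝ} (hR' : R' ∈ achievableRates H S c) (k : Fin K) : R' k ≤ R := by
  have : NeZero p := ⟨by omega⟩
  have hp0 : (0 : ℝ) < p := by exact_mod_cast (by omega : 0 < p)
  have hl : 0 < Real.logb 2 p := Real.logb_pos (by norm_num) (by exact_mod_cast hp)
  refine le_of_forall_pos_le_add fun η hη => ?_
  obtain ⟨n, h1, hn⟩ := ((hR'.2.1 k η hη).and (eventually_ge_atTop 1)).exists
  have hn0 : (0 : ℝ) < n := by exact_mod_cast hn
  rw [(hc n).card_messages k] at h1
  push_cast at h1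
  have h2 := Real.logb_le_logb_of_le (b := 2) (by norm_num) (by positivity) h1
  rw [Real.logb_rpow (by norm_num) (by norm_num), Real.logb_pow] at h2
  have h3 : (⌊(n : ℝ) * R / Real.logb 2 p⌋₊ : ℝ) * Real.logb 2 p ≤ n * R := by
    rw [← le_div_iff₀ hl]
    exact Nat.floor_le (by positivity)
  have h4 := le_of_mul_le_mul_left (h2.trans h3) hn0
  linarith

theorem const_mem_achievableRates {K p : ℕ} (hp : 2 ≤ p) {H : Fin K → Fin K → ℝ} {S R : ℝ}
    (hR : 0 ≤ R) {c : (n : ℕ) → ICCode K n}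
    (hc : ∀ n : ℕ, (c n).IsLatticeAlignment p ⌊(n : ℝ) * R / Real.logb 2 p⌋₊)
    (herr : Tendsto (fun n => (c n).errorProb H S) atTop (𝓝 0)) :
    (fun _ => R) ∈ achievableRates H S c := by
  have : NeZero p := ⟨by omega⟩
  have hp0 : (0 : ℝ) < p := by exact_mod_cast (by omega : 0 < p)
  have hl : 0 < Real.logb 2 p := Real.logb_pos (by norm_num) (by exact_mod_cast hp)
  refine ⟨fun _ => hR, fun k η hη => ?_, herr⟩
  have hlim : Tendsto (fun n : ℕ => (n : ℝ) * η) atTop atTop :=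
    tendsto_natCast_atTop_atTop.atTop_mul_const hη
  filter_upwards [hlim.eventually_ge_atTop (Real.logb 2 p)] with n hn
  rw [(hc n).card_messages k]
  push_cast
  rw [← Real.logb_le_logb (b := 2) (by norm_num) (by positivity) (by positivity),
    Real.logb_rpow (by norm_num) (by norm_num), Real.logb_pow]
  have h1 := mul_le_mul_of_nonneg_right (Nat.lt_floor_add_one ((n : ℝ) * R / Real.logb 2 p)).le hl.le
  rw [div_mul_cancel₀ _ hl.ne'] at h1
  linarith

theorem ICCode.errorProb_nonneg {K n : ℕ} (c : ICCode K n) (H : Fin K → Fin K → ℝ) (S : ℝ) :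
    0 ≤ c.errorProb H S :=
  div_nonneg (Finset.sum_nonneg fun _ _ => measureReal_nonneg)
    (Finset.prod_nonneg fun _ _ => Nat.cast_nonneg _)

/-- For large `S` the best sum rate of the scheme is exactly `K * R S`, so the limsup is a genuine
limit. -/
theorem achievesDoF_of_tendsto {K : ℕ} {H : Fin K → Fin K → ℝ} {C : ℝ → (n : ℕ) → ICCode K n}
    {p : ℝ → ℕ} {R : ℝ → ℝ} (hp : ∀ S, 2 ≤ p S)
    (hC : ∀ S n, (C S n).IsLatticeAlignment (p S) ⌊(n : ℝ) * R S / Real.logb 2 (p S : ℝ)⌋₊)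
    (hR : ∀ᶠ S : ℝ in atTop, 0 ≤ R S)
    (hach : ∀ᶠ S : ℝ in atTop, (fun _ : Fin K => R S) ∈ achievableRates H S (C S))
    (hlim : Tendsto (fun S : ℝ => R S / (1 / 4 * Real.logb 2 S)) atTop (𝓝 1)) :
    AchievesDoF H C ((K : ℝ) / 2) := by
  have h1 : Tendsto (fun S : ℝ => ((K * R S / (1 / 2 * Real.logb 2 S) : ℝ) : EReal)) atTop
      (𝓝 (((K : ℝ) / 2 : ℝ) : EReal)) := by
    refine (continuous_coe_real_ereal.tendsto _).comp ?_
    have h2 := hlim.const_mul ((K : ℝ) / 2)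
    rw [mul_one] at h2
    refine h2.congr fun S => ?_
    ring
  unfold AchievesDoF
  refine Eq.trans (limsup_congr ?_) h1.limsup_eq
  filter_upwards [hR, hach, eventually_gt_atTop 1] with S h2 h3 hS
  have hlog : 0 < Real.logb 2 S := Real.logb_pos (by norm_num) hS
  refine le_antisymm (iSup₂_le fun R' hR' => ?_) ?_
  · rw [EReal.coe_le_coe_iff]
    gcongr
    refine (Finset.sum_le_card_nsmul _ _ _ fun k _ =>
      le_of_mem_achievableRates (hp S) h2 (hC S) hR' k).trans (le_of_eq ?_)
    simp
  · refine le_iSup₂_of_le _ h3 (le_of_eq ?_)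
    simp

/-! ### Primes and codes for the degrees of freedom -/

theorem exists_tendsto_eventually_diagonal {P : ℕ → ℝ → Prop}
    (h : ∀ m, ∀ᶠ S : ℝ in atTop, P m S) :
    ∃ f : ℝ → ℕ, Tendsto f atTop atTop ∧ ∀ᶠ S : ℝ in atTop, P (f S) S := by
  classical
  choose T hT using fun m => eventually_atTop.mp (h m)
  -- The largest index whose threshold `T m` has been passed; the cap `⌊S⌋₊` keeps the search
  -- finite.
  refine ⟨fun S => Nat.findGreatest (fun m => T m ≤ S) ⌊S⌋₊, tendsto_atTop.mpr fun b => ?_, ?_⟩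
  · filter_upwards [eventually_ge_atTop (T b), eventually_ge_atTop (b : ℝ)] with S h1 h2
    exact Nat.le_findGreatest (Nat.le_floor h2) h1
  · filter_upwards [eventually_ge_atTop (T 0)] with S h1
    exact hT _ S (Nat.findGreatest_spec (P := fun m => T m ≤ S) (Nat.zero_le _) h1)

/-- `p` is a prime slightly below `S^{1/4}` (up to the tolerance `1/N`) for which the
constellation is well separated and the symmetric rate is close to `¼ log S`. -/
structure GoodPrime {K : ℕ} (h : Fin K → ℝ) (N : ℕ) (S : ℝ) (p : ℕ) : Prop where
  one_lt : 1 < S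
  prime : p.Prime
  odd : Odd p
  exponent_pos : 0 < 1 / 4 - Real.logb S p
  exponent_le : 1 / 4 - Real.logb S p ≤ 2 * (1 / N)
  admissible : ∀ j, p ∈ admissiblePrimes S (h j)
  rate_pos : 0 < symRateAt h p S
  rate_close : |symRateAt h p S / (1 / 4 * Real.logb 2 S) - 1| ≤ 5 * (1 / N)
  lt_logb : N < Real.logb 2 p
  delta_pos : ∀ j, 0 < dioDelta p (h j)
  noise_le : ∀ j, 1 / (S * (latL / (2 * p) * dioDelta p (h j)) ^ 2) ≤ (1 / 4) ^ (2 * N)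

/-- The fixed-`ε` results at `ε = 1/N`. Taking `N ≥ 5` ensures `ε < 1/4` and `1 - 5ε ≥ 0`, whence a
positive rate. -/
theorem eventually_exists_goodPrime {K : ℕ} (hK : 1 ≤ K) {h : Fin K → ℝ}
    (hh : ∀ j, DiophantineGain (h j)) {N : ℕ} (hN : 5 ≤ N) :
    ∀ᶠ S : ℝ in atTop, ∃ p, GoodPrime h N S p := by
  have hN5 : (5 : ℝ) ≤ N := by exact_mod_cast hN
  set ε : ℝ := 1 / N with hε_def
  have hε : 0 < ε := by positivity
  have hε5 : ε ≤ 1 / 5 := one_div_le_one_div_of_le (by norm_num) hN5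
  have hε4 : ε < 1 / 4 := by linarith
  have hlog : Tendsto (fun S : ℝ => Real.logb 2 S) atTop atTop :=
    Real.tendsto_logb_atTop (by norm_num)
  obtain ⟨p, e, he_def, hp, he⟩ := exists_primes_rpow hε4
  have hrate := tendsto_symRateAt_div hK hh hε hε4 hp he
  have hsmall := (tendsto_rpow_neg_atTop hε).eventually_le_const
    (show (0 : ℝ) < (1 / 4) ^ (2 * N) by positivity)
  filter_upwards [hp, he.eventually_const_lt hε,
    he.eventually_le_const (show ε < 2 * ε by linarith),
    eventually_forall_mem_admissiblePrimes hh hε hε4 hp he,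
    hrate.eventually_const_lt (show 1 - 5 * ε < 1 - 4 * ε by linarith),
    hrate.eventually_lt_const (show 1 - 4 * ε < 1 by linarith),
    hlog.eventually_gt_atTop 0, eventually_gt_atTop 1,
    eventually_prime_separation hh hε hε4 hp he,
    (tendsto_rpow_atTop (show 0 < (1 / 4 - ε) / 2 by linarith)).eventually_gt_atTop
      ((2 : ℝ) ^ N), hsmall] with S hpS he1 he2 hadm hr1 hr2 hl hS hsep hbig hsm
  have hp0 : (0 : ℝ) < p S := by exact_mod_cast hpS.1.pos
  have hpN : (2 : ℝ) ^ N < p S := hbig.trans_le hsep.1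
  have hδ : ∀ j, 0 < dioDelta (p S) (h j) := fun j => (hh j).1.dioDelta_pos hpS.1.two_le
  rw [he_def] at he1 he2
  refine ⟨p S, hS, hpS.1, ?_, he1, he2, hadm, ?_, ?_, ?_, hδ, fun j => ?_⟩
  · refine hpS.1.odd_of_ne_two fun h2 => ?_
    rw [h2] at hpN
    have := one_lt_pow₀ (show (1 : ℝ) < 2 by norm_num) (show N - 1 ≠ 0 by omega)
    have h3 : (2 : ℝ) ^ N = 2 ^ (N - 1) * 2 := by rw [← pow_succ]; congr 1; omega
    push_cast at hpN
    linarith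
  · by_contra hcon
    have := div_nonpos_of_nonpos_of_nonneg (not_lt.mp hcon)
      (show 0 ≤ 1 / 4 * Real.logb 2 S by positivity)
    linarith
  · rw [abs_le]
    constructor <;> linarith
  · rw [Real.lt_logb_iff_rpow_lt (by norm_num) hp0, Real.rpow_natCast]
    exact hpN
  · refine le_trans ?_ hsm
    have hS0 : 0 < S := by linarith
    have h1 := hsep.2.2 j
    -- The factor 3 is `L²/4`.
    have h2 : S * (latL / (2 * p S) * dioDelta (p S) (h j)) ^ 2
        = 3 * (dioDelta (p S) (h j) ^ 2 * S / (p S : ℝ) ^ 2) := by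
      rw [mul_pow, div_pow, latL_sq]
      field_simp
      ring
    have h3 : S ^ ε ≤ dioDelta (p S) (h j) ^ 2 * S / (p S : ℝ) ^ 2 := by
      rwa [le_div_iff₀ (by positivity)]
    have h4 : 0 < S ^ ε := Real.rpow_pos_of_pos hS0 ε
    rw [h2, Real.rpow_neg hS0.le, ← one_div]
    exact one_div_le_one_div_of_le h4 (by linarith)

theorem exists_scheme {K : ℕ} (hK : 1 ≤ K) (a : Fin K → Fin K → ℤ) {h : Fin K → ℝ}
    (hh : ∀ j, DiophantineGain (h j)) :
    ∃ (p : ℝ → ℕ) (e : ℝ → ℝ) (R : ℝ → ℝ) (C : ℝ → (n : ℕ) → ICCode K n),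
      (∀ S, (p S).Prime) ∧
      (∀ᶠ S : ℝ in atTop, (p S : ℝ) = S ^ (1 / 4 - e S) ∧ 0 < e S) ∧
      Tendsto e atTop (𝓝 0) ∧
      (∀ᶠ S : ℝ in atTop, ∀ j, p S ∈ admissiblePrimes S (h j)) ∧
      Tendsto (fun S : ℝ => symRateAt h (p S) S / (1 / 4 * Real.logb 2 S)) atTop (𝓝 1) ∧
      (∀ᶠ S : ℝ in atTop, 0 < R S ∧ R S < symRateAt h (p S) S) ∧
      (∀ S n, (C S n).IsLatticeAlignment (p S) ⌊(n : ℝ) * R S / Real.logb 2 (p S : ℝ)⌋₊) ∧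
      (∀ᶠ S : ℝ in atTop, (fun _ : Fin K => R S) ∈
        achievableRates (integerGains h a) S (C S)) ∧
      AchievesDoF (integerGains h a) C ((K : ℝ) / 2) := by
  classical
  obtain ⟨f, hf, hgood⟩ := exists_tendsto_eventually_diagonal
    (P := fun m S => ∃ p, GoodPrime h (m + 5) S p)
    (fun m => eventually_exists_goodPrime hK hh (by omega))
  have hex : ∀ S, ∃ p : ℕ, p.Prime ∧ Odd p ∧
      ((∃ q, GoodPrime h (f S + 5) S q) → GoodPrime h (f S + 5) S p) := by
    intro S
    by_cases hS : ∃ q, GoodPrime h (f S + 5) S q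
    · obtain ⟨q, hq⟩ := hS
      exact ⟨q, hq.prime, hq.odd, fun _ => hq⟩
    -- Default for small `S`: any odd prime, so that codes exist for every `S`.
    · exact ⟨3, Nat.prime_three, by decide, fun h => absurd h hS⟩
  choose p hp hodd hpgood using hex
  replace hgood : ∀ᶠ S : ℝ in atTop, GoodPrime h (f S + 5) S (p S) :=
    hgood.mono fun S hS => hpgood S hS
  set N : ℝ → ℕ := fun S => f S + 5 with hN_def
  have hN5 : ∀ S, (5 : ℝ) ≤ N S := fun S => by simp [hN_def]
  have hN : Tendsto (fun S => (1 : ℝ) / N S) atTop (𝓝 0) := by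
    have h1 : Tendsto N atTop atTop := tendsto_atTop_mono (fun S => Nat.le_add_right _ _) hf
    exact (tendsto_natCast_atTop_atTop.comp h1).const_div_atTop 1
  -- The rate gives up `2 (log p)/N`: one share pays for the code's distance, the other exceeds the
  -- extra bit because `log p > N`.
  set R : ℝ → ℝ := fun S => (1 - 2 * (1 / N S)) * symRateAt h (p S) S with hR_def
  have hcode : ∀ S n, _ := fun S n =>
    haveI : Fact (p S).Prime := ⟨hp S⟩
    exists_latticeAlignment_errorProb_le (hodd S) (N S) (by simp [hN_def]) h a (R S) n
  choose C hC herr using hcode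
  have hrate : Tendsto (fun S : ℝ => symRateAt h (p S) S / (1 / 4 * Real.logb 2 S)) atTop
      (𝓝 1) := by
    rw [tendsto_iff_dist_tendsto_zero]
    refine squeeze_zero' (.of_forall fun _ => dist_nonneg) (hgood.mono fun S hS => hS.rate_close)
      (by simpa only [mul_zero] using hN.const_mul 5)
  have hRpos : ∀ᶠ S : ℝ in atTop, 0 < R S ∧ R S < symRateAt h (p S) S := by
    filter_upwards [hgood] with S hS
    have h1 : 0 < (1 : ℝ) / N S := one_div_pos.mpr (by linarith [hN5 S])
    have h2 : (1 : ℝ) / N S ≤ 1 / 5 := one_div_le_one_div_of_le (by norm_num) (hN5 S)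
    have h3 := hS.rate_pos
    refine ⟨mul_pos (by linarith) h3, ?_⟩
    simp only [hR_def]
    nlinarith
  have hach : ∀ᶠ S : ℝ in atTop, (fun _ : Fin K => R S) ∈
      achievableRates (integerGains h a) S (C S) := by
    filter_upwards [hgood, hRpos] with S hS hRS
    refine const_mem_achievableRates (hp S).two_le hRS.1.le (hC S) ?_
    have hlt : R S + 1 + Real.logb 2 (p S) / N S < Real.logb 2 (p S) := by
      have h1 : 0 < (1 : ℝ) / N S := one_div_pos.mpr (by linarith [hN5 S])
      have h2 : (1 : ℝ) / N S ≤ 1 / 5 := one_div_le_one_div_of_le (by norm_num) (hN5 S)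
      have h3 := symRateAt_le_logb hK h (hp S).one_le S
      have h4 : 1 < Real.logb 2 (p S) / N S := by
        rw [one_lt_div (by linarith [hN5 S])]
        exact hS.lt_logb
      have h5 : R S ≤ (1 - 2 * (1 / N S)) * Real.logb 2 (p S) :=
        mul_le_mul_of_nonneg_left h3 (by linarith)
      have h6 : (1 - 2 * (1 / (N S : ℝ))) * Real.logb 2 (p S)
          = Real.logb 2 (p S) - 2 * (Real.logb 2 (p S) / N S) := by ring
      linarith
    have hlim : Tendsto (fun n : ℕ => (K : ℝ) * (1 / 2) ^ n) atTop (𝓝 0) := by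
      simpa using (tendsto_pow_atTop_nhds_zero_of_lt_one (show (0 : ℝ) ≤ 1 / 2 by norm_num)
        (by norm_num)).const_mul (K : ℝ)
    refine squeeze_zero' (.of_forall fun n => (C S n).errorProb_nonneg _ _) ?_ hlim
    filter_upwards [eventually_ge_atTop 1] with n hn
    exact herr S n hn hRS.1.le hlt S (by linarith [hS.one_lt]) hS.delta_pos hS.noise_le
  refine ⟨p, fun S => 1 / 4 - Real.logb S (p S), R, C, hp, ?_, ?_,
    hgood.mono fun S hS => hS.admissible, hrate, hRpos, hC, hach,
    achievesDoF_of_tendsto (fun S => (hp S).two_le) hC (hRpos.mono fun S hS => hS.1.le) hach ?_⟩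
  · filter_upwards [hgood] with S hS
    have h1 := hS.one_lt
    refine ⟨?_, hS.exponent_pos⟩
    rw [sub_sub_cancel, Real.rpow_logb (by linarith) h1.ne' (by exact_mod_cast (hp S).pos)]
  · exact squeeze_zero' (hgood.mono fun S hS => hS.exponent_pos.le)
      (hgood.mono fun S hS => hS.exponent_le) (by simpa only [mul_zero] using hN.const_mul 2)
  · have h1 := ((hN.const_mul 2).const_sub 1).mul hrate
    simp only [mul_zero, sub_zero, mul_one] at h1
    exact h1.congr fun S => by simp only [hR_def]; ring

theorem mainTheorem3 (K : ℕ) (hK : 1 ≤ K) (a : Fin K → Fin K → ℤ) :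
    -- the Diophantine bound for almost every gain
    (∀ᵐ γ : ℝ, ∀ ε : ℝ, 0 < ε → ∀ᶠ p : ℕ in atTop, (p : ℝ) ^ (-1 - ε) ≤ dioDelta p γ) ∧
    -- for almost every choice of the direct gains:
    ∀ᵐ h : Fin K → ℝ,
      -- a prime `p = S^{1/4 - e(S)}` with `e(S) → ε` is admissible and gives the factor `1 - 4ε`
      (∀ ε : ℝ, 0 < ε → ε < 1 / 4 → ∀ (p : ℝ → ℕ) (e : ℝ → ℝ),
        (∀ᶠ S : ℝ in atTop, (p S).Prime ∧ (p S : ℝ) = S ^ (1 / 4 - e S)) →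
        Tendsto e atTop (𝓝 ε) →
          (∀ᶠ S : ℝ in atTop, ∀ j, p S ∈ admissiblePrimes S (h j)) ∧
          Tendsto (fun S : ℝ => symRateAt h (p S) S / (1 / 4 * Real.logb 2 S)) atTop
            (𝓝 (1 - 4 * ε))) ∧
      -- the symmetric rate is an attained maximum for large `S`, and is `~ ¼ log S`
      (∀ᶠ S : ℝ in atTop, IsGreatest (symRateValues h S) (symRate h S)) ∧
      Tendsto (fun S : ℝ => symRate h S / (1 / 4 * Real.logb 2 S)) atTop (𝓝 1) ∧
      -- with primes `p = S^{1/4 - e(S)}`, `e(S) > 0`, `e(S) → 0`, the rate for `p` is `~ ¼ log S`,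
      -- and lattice-alignment codes over `ℤ_p` of a rate below it achieve `K/2` degrees of freedom
      ∃ (p : ℝ → ℕ) (e : ℝ → ℝ) (R : ℝ → ℝ) (C : ℝ → (n : ℕ) → ICCode K n),
        (∀ S, (p S).Prime) ∧
        (∀ᶠ S : ℝ in atTop, (p S : ℝ) = S ^ (1 / 4 - e S) ∧ 0 < e S) ∧
        Tendsto e atTop (𝓝 0) ∧
        (∀ᶠ S : ℝ in atTop, ∀ j, p S ∈ admissiblePrimes S (h j)) ∧
        Tendsto (fun S : ℝ => symRateAt h (p S) S / (1 / 4 * Real.logb 2 S)) atTop (𝓝 1) ∧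
        (∀ᶠ S : ℝ in atTop, 0 < R S ∧ R S < symRateAt h (p S) S) ∧
        (∀ S n, (C S n).IsLatticeAlignment (p S) ⌊(n : ℝ) * R S / Real.logb 2 (p S : ℝ)⌋₊) ∧
        (∀ᶠ S : ℝ in atTop, (fun _ : Fin K => R S) ∈
          achievableRates (integerGains h a) S (C S)) ∧
        AchievesDoF (integerGains h a) C ((K : ℝ) / 2) := by
  refine ⟨ae_diophantineGain.mono fun γ hγ => hγ.2, ?_⟩
  filter_upwards [ae_forall_diophantineGain K] with h hh
  exact ⟨fun ε hε hε4 p e hp he => ⟨eventually_forall_mem_admissiblePrimes hh hε hε4 hp he,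
      tendsto_symRateAt_div hK hh hε hε4 hp he⟩,
    eventually_isGreatest_symRate hK hh, tendsto_symRate_div hK hh, exists_scheme hK a hh⟩
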